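/- Let $\lambda_1\le\lambda_2\le\dots\le\lambda_\ell$ ($\ell\ge 1$) be positive integers, $N=\sum_i\lambda_i$, and $k_i=\lambda_i+i-1$ for $i=1,\dots,\ell$. Let $h(n,x)=H_n(x)$ be the classical Hermite polynomials for $n\ge 0$ (leading coefficient $2^n$), with $h(n,x)=0$ for $n<0$. With $\mathrm{Wr}$ the Wronskian with respect to $x$, put $$\eta=\mathrm{Wr}[h(k_1,x),\dots,h(k_\ell,x)],\qquad A(y)=\mathrm{Wr}[h(k_1,x),\dots,h(k_\ell,x),y],$$ $$\tilde h_j=\mathrm{Wr}[h(k_1,x),\dots,\widehat{h(k_j,x)},\dots,h(k_\ell,x)],\qquad B(y)=(-1)^{\lfloor \ell/2\rfloor}e^{x^2}\eta^{-\ell}\,\mathrm{Wr}[\tilde h_1,\dots,\tilde h_\ell,e^{-x^2}y],$$ where the hat indicates omission. The exceptional Hermite polynomials are $\hat h(n,x)=A(h(n+\ell-N,x))$. Let $\mathcal I=\{n\in\mathbb Z_{\ge0}: n\ge N-\ell,\ n+\ell-N\notin\{k_1,\dots,k_\ell\}\}$, $\mathcal U=\mathrm{span}_{\mathbb C}\{\hat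 h(n,x):n\in\mathcal I\}$, and $\mathcal S=\{f\in\mathbb C[x]: f\,\hat h(n,x)\in\mathcal U\text{ for all }n\in\mathcal I\}$ (the stabilizer ring). Let $\Theta$ be the shift $n\mapsto n+1$, $\Theta(u(n))=u(n+1)$, and consider difference operators $\sum_j c_j(n)\Theta^j$ (finite sums over $j\in\mathbb Z$, $c_j\in\mathbb C(n)$). Put $\Delta=\tfrac12\Theta+n\circ\Theta^{-1}$, $\Gamma=2n\circ\Theta^{-1}$, let $\flat$ be the linear map from $\mathbb C[x,\partial]$ to difference operators with $\flat(x^i\partial^j)=\Gamma^j\Delta^i$, and put $\pi(n)=\prod_{i=1}^\ell(-2n+2k_i)$. Then for every $f\in\mathcal S$ the operator $B\circ f\circ A$ is a (unique) element of $\mathbb C[x,\partial]$, and the difference operator $$\hat\Delta_f=\Theta^{\ell-N}\circ\flat(B\circ f\circ A)\circ\frac1{\pi(n)}\circ\Theta^{N-\ell}$$ has coefficients without poles at the integers $n\ge N-\ell$ and satisfies $$\hat\Delta_f\,\hat h(n,x)=f(x)\,\hat h(n,x)\qquad\text{for all integers } n\ge N-\ell,$$ in particular for all $n\in\mathcal I$.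 -/

import Mathlib

open Polynomial
open scoped ContDiff

noncomputable section

namespace XHermite

/-! ### Wronskians and Hermite polynomials -/

/-- The Wronskian `Wr[v₀, …, v_{m-1}]`, the determinant with entries `∂ⁱ vⱼ`, in a commutative ring
`R` with a map `D : R → R` playing the role of `∂`. It is used with `Polynomial.derivative` on
`ℂ[X]` and with `deriv` on functions `ℝ → ℂ`. -/
def wr {R : Type*} [CommRing R] (D : R → R) {m : ℕ} (v : Fin m → R) : R :=
  Matrix.det (Matrix.of fun i j : Fin m => D^[(i : ℕ)] (v j))

/-- The classical (physicists') Hermite polynomials: `H₀ = 1`, `Hₙ₊₁ = 2 x Hₙ - Hₙ'`. -/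
def hermiteH : ℕ → ℂ[X]
  | 0 => 1
  | n + 1 => 2 * X * hermiteH n - derivative (hermiteH n)

/-- `h(n, x)` for an integer `n`: the `n`-th Hermite polynomial, and `0` for `n < 0`. -/
def hermiteZ : ℤ → ℂ[X]
  | Int.ofNat n => hermiteH n
  | Int.negSucc _ => 0

/-! ### Exceptional Hermite polynomials

A partition with `ℓ = m + 1` parts is given by `lam : Fin (m + 1) → ℕ`. -/

section Exceptional

variable {m : ℕ} (lam : Fin (m + 1) → ℕ)

/-- `N = ∑ λᵢ`. -/
def partN : ℕ := ∑ i, lam i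

/-- `N - ℓ`, as an integer. -/
def offset : ℤ := (partN lam : ℤ) - (m + 1 : ℕ)

/-- `kᵢ = λᵢ + i - 1`, where the index `i : Fin (m + 1)` starts from `0` instead of `1`. -/
def kk (i : Fin (m + 1)) : ℕ := lam i + i

/-- The tuple `h(k₁, x), …, h(k_ℓ, x)`. -/
def hTuple (i : Fin (m + 1)) : ℂ[X] := hermiteZ (kk lam i)

/-- `η = Wr[h(k₁, x), …, h(k_ℓ, x)]`. -/
def eta : ℂ[X] := wr (fun p => derivative p) (hTuple lam)

/-- The polynomial `h̃ⱼ`, the Wronskian of the tuple with `h(kⱼ, x)` omitted. -/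
def hTilde (j : Fin (m + 1)) : ℂ[X] :=
  wr (fun p => derivative p) fun i : Fin m => hTuple lam (j.succAbove i)

/-- The operator `A` on polynomials. -/
def opAPoly (p : ℂ[X]) : ℂ[X] :=
  wr (fun p => derivative p) (Fin.snoc (α := fun _ => ℂ[X]) (hTuple lam) p)

/-- The exceptional Hermite polynomial `ĥ(n, x) = A(h(n + ℓ - N, x))`. -/
def hHat (n : ℤ) : ℂ[X] := opAPoly lam (hermiteZ (n - offset lam))

/-- The degree sequence: `n ≥ 0`, `n ≥ N - ℓ` and `n + ℓ - N ∉ {k₁, …, k_ℓ}`. -/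
def degSet : Set ℤ :=
  {n | 0 ≤ n ∧ offset lam ≤ n ∧ ∀ i, n - offset lam ≠ kk lam i}

/-- The span `𝓤` of the exceptional Hermite polynomials. -/
def spanU : Submodule ℂ ℂ[X] := Submodule.span ℂ (hHat lam '' degSet lam)

/-- The stabilizer ring `𝓢`. -/
def stabilizer : Set ℂ[X] := {f | ∀ n ∈ degSet lam, f * hHat lam n ∈ spanU lam}

/-! ### The differential operators `A` and `B` on functions of a real variable -/

/-- A polynomial as a function `ℝ → ℂ`. -/
def polyFun (p : ℂ[X]) : ℝ → ℂ := fun x => p.eval (x : ℂ)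

/-- `A(y) = Wr[h(k₁, x), …, h(k_ℓ, x), y]`. -/
def opA (y : ℝ → ℂ) : ℝ → ℂ :=
  wr deriv (Fin.snoc (α := fun _ => ℝ → ℂ) (fun i => polyFun (hTuple lam i)) y)

/-- `B(y) = (-1)^⌊ℓ/2⌋ e^{x²} η^{-ℓ} Wr[h̃₁, …, h̃_ℓ, e^{-x²} y]`, meaningful where `η(x) ≠ 0`. -/
def opB (y : ℝ → ℂ) : ℝ → ℂ := fun x =>
  (-1) ^ ((m + 1) / 2) * Complex.exp ((x : ℂ) ^ 2) * (polyFun (eta lam) x ^ (m + 1))⁻¹ *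
    wr deriv (Fin.snoc (α := fun _ => ℝ → ℂ) (fun j => polyFun (hTilde lam j))
      (fun t : ℝ => Complex.exp (-(t : ℂ) ^ 2) * y t)) x

end Exceptional

/-! ### Polynomial coefficient differential operators -/

/-- An element of `ℂ[x, ∂]`, written uniquely as `∑ⱼ aⱼ(x) ∂ʲ` with finitely many nonzero `aⱼ`;
the polynomial `aⱼ` is the value at `j`. -/
abbrev PolyDiffOp : Type := ℕ →₀ ℂ[X]

/-- The action `(∑ⱼ aⱼ ∂ʲ) y = ∑ⱼ aⱼ y⁽ʲ⁾`. -/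
def PolyDiffOp.apply (Q : PolyDiffOp) (y : ℝ → ℂ) : ℝ → ℂ := fun x =>
  Q.sum fun j a => polyFun a x * iteratedDeriv j y x

/-- `Q = B ∘ f ∘ A` as differential operators: both sides agree on every smooth function at every
point where the rational coefficients of `B` are defined. -/
def IsBfA {m : ℕ} (lam : Fin (m + 1) → ℕ) (f : ℂ[X]) (Q : PolyDiffOp) : Prop :=
  ∀ y : ℝ → ℂ, ContDiff ℝ ∞ y → ∀ x : ℝ, polyFun (eta lam) x ≠ 0 →
    Q.apply y x = opB lam (polyFun f * opA lam y) x

/-! ### Difference operators with rational coefficients in `n` -/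

/-- The substitution `r(n) ↦ r(n + c)` on `ℂ(n)`. -/
def shiftHom (c : ℂ) : RatFunc ℂ →+* RatFunc ℂ :=
  RatFunc.mapRingHom (taylorEquiv c)
    (nonZeroDivisors_le_comap_nonZeroDivisors_of_injective _ (taylorEquiv c).injective)

theorem shiftHom_div (c : ℂ) (p q : ℂ[X]) :
    shiftHom c (algebraMap _ _ p / algebraMap _ _ q) =
      algebraMap _ _ (taylor c p) / algebraMap _ _ (taylor c q) := by
  have e : ∀ r : ℂ[X], shiftHom c (algebraMap _ _ r) = algebraMap _ _ (taylor c r) := by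
    intro r
    have := RatFunc.map_apply_div (taylorEquiv c)
      (nonZeroDivisors_le_comap_nonZeroDivisors_of_injective _ (taylorEquiv c).injective) r 1
    simp only [map_one, div_one] at this
    exact this
  rw [map_div₀, e, e]

/-- The integer `j` (written multiplicatively) acts on `ℂ(n)` by `r(n) ↦ r(n + j)`. -/
instance shiftAction : MulSemiringAction (Multiplicative ℤ) (RatFunc ℂ) where
  smul g r := shiftHom (g.toAdd : ℂ) r
  one_smul r := by
    induction r using RatFunc.induction_on with
    | f p q hq =>
      change shiftHom _ _ = _
      rw [shiftHom_div]; simp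
  mul_smul g g' r := by
    induction r using RatFunc.induction_on with
    | f p q hq =>
      change shiftHom _ _ = shiftHom _ (shiftHom _ _)
      rw [shiftHom_div, shiftHom_div, shiftHom_div, taylor_taylor, taylor_taylor]
      simp
  smul_zero g := map_zero (shiftHom _)
  smul_add g := map_add (shiftHom _)
  smul_one g := map_one (shiftHom _)
  smul_mul g := map_mul (shiftHom _)

/-- The ring of difference operators `∑ⱼ cⱼ(n) Θʲ` (`j ∈ ℤ`, finite sums, `cⱼ ∈ ℂ(n)`), with
composition `Θ ∘ c(n) = c(n + 1) ∘ Θ`. -/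
abbrev DiffceOp : Type := SkewMonoidAlgebra (RatFunc ℂ) (Multiplicative ℤ)

namespace DiffceOp

/-- The power `Θʲ` of the shift operator, `j ∈ ℤ`. -/
def shift (j : ℤ) : DiffceOp := SkewMonoidAlgebra.single (Multiplicative.ofAdd j) 1

/-- The operator of multiplication by `r(n)`. -/
def mulBy (r : RatFunc ℂ) : DiffceOp := SkewMonoidAlgebra.single 1 r

/-- The coefficient `cⱼ(n)` of `Θʲ`. -/
def coef (P : DiffceOp) (j : ℤ) : RatFunc ℂ := P.coeff (Multiplicative.ofAdd j)

/-- None of the coefficients of `P` has a pole at `n`. -/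
def RegularAt (P : DiffceOp) (n : ℤ) : Prop := ∀ j, (P.coef j).denom.eval (n : ℂ) ≠ 0

/-- The action on sequences, `(P u)(n) = ∑ⱼ cⱼ(n) u(n + j)`, meaningful where `P` is regular. -/
def act (P : DiffceOp) (u : ℤ → ℂ[X]) (n : ℤ) : ℂ[X] :=
  P.sum fun g c => C (c.eval (RingHom.id ℂ) (n : ℂ)) * u (n + g.toAdd)

/-- `Δ = ½ Θ + n ∘ Θ⁻¹`. -/
def Delta : DiffceOp := mulBy (RatFunc.C (1 / 2)) * shift 1 + mulBy RatFunc.X * shift (-1)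

/-- `Γ = 2 n ∘ Θ⁻¹`. -/
def Gamma : DiffceOp := mulBy (2 * RatFunc.X) * shift (-1)

end DiffceOp

/-- The map `♭`, the linear extension of `xⁱ ∂ʲ ↦ Γʲ Δⁱ`. -/
def flat (Q : PolyDiffOp) : DiffceOp :=
  Q.sum fun j a => a.sum fun i c =>
    DiffceOp.mulBy (RatFunc.C c) * (DiffceOp.Gamma ^ j * DiffceOp.Delta ^ i)

/-- `π(n) = ∏ᵢ (-2 n + 2 kᵢ)`. -/
def piPoly {m : ℕ} (lam : Fin (m + 1) → ℕ) : RatFunc ℂ :=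
  ∏ i, (-2 * RatFunc.X + 2 * RatFunc.C (kk lam i : ℂ))

/-- `Θ^{ℓ-N} ∘ ♭(Q) ∘ (1/π(n)) ∘ Θ^{N-ℓ}`. For `Q = B ∘ f ∘ A` this is `Δ̂_f`. -/
def hatDelta {m : ℕ} (lam : Fin (m + 1) → ℕ) (Q : PolyDiffOp) : DiffceOp :=
  DiffceOp.shift (-offset lam) * flat Q * DiffceOp.mulBy (piPoly lam)⁻¹ *
    DiffceOp.shift (offset lam)

end XHermite

end

open XHermite

/-!
The composition of `A` and `B` acts on Hermite polynomials as a scalar, `B (A Hₙ) = π(n) Hₙ`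
(`wrGauss_opAPoly_hermiteH`). Everything else follows from this identity by comparing coefficients.

For the identity, let `c₁, …, c_ℓ` be the eigenvalues of `h(k₁, x), …, h(k_ℓ, x)` under
`T = ∂² - 2x∂`, and let `T y = μ y`. Row operations turn the derivatives in `Wr[h₁, …, h_ℓ, y]` into
powers of `T`, so the Wronskian depends on `μ` through a polynomial of degree less than `ℓ`, and
interpolation at the `cⱼ` gives (`wr_snoc_eq_sum`)
`A y = ∑ⱼ ± h̃ⱼ ∏_{i ≠ j} (μ - cᵢ) Wr[hⱼ, y]`.
Now `(e^{-x²} Wr[hⱼ, y])' = (μ - cⱼ) e^{-x²} hⱼ y`, while the sums `∑ⱼ ± h̃ⱼ⁽ⁱ⁾ hⱼ` vanish for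
`i < ℓ - 1` and equal `± η` for `i = ℓ - 1`. Hence, in the determinant defining `B (A y)`, the last
column is a combination of the others except for one entry `π η y` (`wrGauss_wr_snoc`). The
remaining minor is `Wr[h̃₁, …, h̃_ℓ] = (-1)^⌊ℓ/2⌋ η^(ℓ-1)` (`wr_wrOmit_mul`).

If `f` is in the stabilizer ring, then `f · A Hₙ = ∑ᵢ γᵢ A Hᵢ`, where `i` avoids the `kⱼ`, for every
`n ≥ 0`. Therefore `B ∘ f ∘ A` maps `Hₙ` to the polynomial `∑ᵢ γᵢ π(i) Hᵢ`. An operator with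
rational coefficients that preserves polynomials has polynomial coefficients (`exists_isBfA`), and
it is determined by its values on polynomials (`IsBfA.unique`).

Finally `♭` turns `x` and `∂` into operators in `n` with the same effect on `h(n, x)` for `n ≥ 0`,
so the coefficient of `Θʲ` in `♭(B ∘ f ∘ A)` has the value `γ_{n+j} π(n + j)` at `n`. It vanishes
when `n + j` is one of the `kᵢ`, which cancels the simple zero of `π(n + j)`; away from these points
division by `π(n + j)` leaves `γ_{n+j}`, and the eigenvalue equation is the expansion of `f · A Hₙ`
(`hatDelta_regularAt_and_act`).
-/

noncomputable section

namespace XHermite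

/-! ### Determinants with a distinguished row or column -/

section Determinants

variable {R : Type*} [CommRing R]

theorem det_of_unitriangular_rows {n : ℕ} (U : ℕ → ℕ → R) (hU : ∀ i, U i i = 1)
    (v v' : Fin n → ℕ → R)
    (h : ∀ j i, v' j i = ∑ k ∈ Finset.range (i + 1), U i k * v j k) :
    (Matrix.of fun i j : Fin n => v' j i).det = (Matrix.of fun i j : Fin n => v j i).det := by
  have e : (Matrix.of fun i j : Fin n => v' j i) =
      (Matrix.of fun i k : Fin n => if (k : ℕ) ≤ i then U i k else 0) *
        (Matrix.of fun i j : Fin n => v j i) := by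
    ext i j
    simp only [Matrix.of_apply, Matrix.mul_apply, h, ite_mul, zero_mul]
    rw [Fin.sum_univ_eq_sum_range (fun k => if k ≤ (i : ℕ) then U i k * v j k else 0),
      ← Finset.sum_filter]
    congr 1
    ext k
    simp only [Finset.mem_range, Finset.mem_filter]
    have := i.2
    omega
  have l : (Matrix.of fun i k : Fin n => if (k : ℕ) ≤ i then U i k else 0).det = 1 := by
    rw [Matrix.det_of_isLowerTriangular]
    · simp [hU]
    · intro i k hik
      have : (i : ℕ) < k := hik
      rw [Matrix.of_apply, if_neg (by omega)]
  rw [e, Matrix.det_mul, l, one_mul]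

/-- Laplace expansion along the last column. Columns are sequences `ℕ → R`, of which the
determinant sees the first `n + 1` entries. -/
theorem det_snoc_column {n : ℕ} (w : Fin n → ℕ → R) (z : ℕ → R) :
    (Matrix.of fun i j : Fin (n + 1) => Fin.snoc (α := fun _ => ℕ → R) w z j i).det =
      ∑ i : Fin (n + 1), (-1) ^ ((i : ℕ) + n) * z i *
        (Matrix.of fun r s : Fin n => w s (i.succAbove r)).det := by
  rw [Matrix.det_succ_column _ (Fin.last n)]
  refine Finset.sum_congr rfl fun i _ => ?_
  congr 1
  · simp
  · congr 1
    ext r s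
    simp

theorem det_eq_of_column {n : ℕ} (M : Matrix (Fin (n + 1)) (Fin (n + 1)) R) (j : Fin (n + 1))
    (h : ∀ i : Fin n, M i.succ j = 0) :
    M.det = (-1) ^ (j : ℕ) * M 0 j * (M.submatrix Fin.succ j.succAbove).det := by
  rw [Matrix.det_succ_column _ j, Fin.sum_univ_succ]
  simp [h]

omit [CommRing R] in
theorem iterate_snoc {n : ℕ} (D : R → R) (v : Fin n → R) (y : R) (i : ℕ) (j : Fin (n + 1)) :
    D^[i] (Fin.snoc (α := fun _ => R) v y j) =
      Fin.snoc (α := fun _ => ℕ → R) (fun j i => D^[i] (v j)) (fun i => D^[i] y) j i := by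
  induction j using Fin.lastCases <;> simp

/-- A Wronskian is a differential operator in its last argument. -/
theorem wr_snoc {n : ℕ} (D : R → R) (v : Fin n → R) (y : R) :
    wr D (Fin.snoc (α := fun _ => R) v y) =
      ∑ i : Fin (n + 1), (-1) ^ ((i : ℕ) + n) * D^[i] y *
        (Matrix.of fun r s : Fin n => D^[(i.succAbove r : ℕ)] (v s)).det := by
  unfold wr
  simp only [iterate_snoc]
  exact det_snoc_column _ _

theorem prod_neg_one_pow_fin (n : ℕ) : ∏ j : Fin n, (-1 : R) ^ (j : ℕ) = (-1) ^ (n / 2) := by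
  induction n with
  | zero => simp
  | succ n ih =>
    rw [Fin.prod_univ_castSucc]
    simp only [Fin.val_castSucc, ih, Fin.val_last, ← pow_add]
    rw [neg_one_pow_eq_pow_mod_two, neg_one_pow_eq_pow_mod_two (n := (n + 1) / 2)]
    obtain ⟨t, rfl | rfl⟩ := Nat.even_or_odd' n <;> congr 1 <;> omega

/-- The sign behind the factor `(-1)^⌊ℓ/2⌋` in the definition of `B`. -/
theorem sign_revPerm (n : ℕ) :
    ((Equiv.Perm.sign (Fin.revPerm : Equiv.Perm (Fin n)) : ℤ) : R) = (-1) ^ (n / 2) := by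
  rw [Equiv.Perm.sign_eq_prod_prod_Iio, ← prod_neg_one_pow_fin]
  push_cast
  refine Finset.prod_congr rfl fun j _ => ?_
  rw [Finset.prod_congr rfl (g := fun _ => (-1 : R))]
  · simp
  · intro i hi
    have := Finset.mem_Iio.1 hi
    simp [this.not_gt]

end Determinants

/-! ### Wronskians of eigenfunctions of `∂² - 2x∂` -/

section Eigenfunctions

/-- The column `(a, b, c a, c b, c² a, c² b, …)`. For `a = g`, `b = g'` and `g'' - 2 x g' = c g` it
is the column `(g, g', T g, (T g)', T² g, …)` with `T = ∂² - 2 x ∂`, which replaces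
`(g, g', g'', …)` in Wronskians. Here `a` and `b` are left arbitrary, since the interpolation in
`c` produces columns in which `a` is not an eigenfunction for the eigenvalue `c`. -/
def eigenJet (c : ℂ) (a b : ℂ[X]) (i : ℕ) : ℂ[X] := C (c ^ (i / 2)) * if Even i then a else b

theorem derivative_eigenJet {c : ℂ} {g : ℂ[X]}
    (hg : derivative (derivative g) = 2 * X * derivative g + C c * g) (k : ℕ) :
    derivative (eigenJet c g (derivative g) k) = eigenJet c g (derivative g) (k + 1) +
      if Even k then 0 else 2 * X * eigenJet c g (derivative g) k := by
  unfold eigenJet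
  by_cases hk : Even k
  · have : (k + 1) / 2 = k / 2 := by obtain ⟨t, rfl⟩ := hk; omega
    simp [hk, Nat.even_add_one, this]
  · have : (k + 1) / 2 = k / 2 + 1 := by
      obtain ⟨t, rfl⟩ := Nat.not_even_iff_odd.1 hk; omega
    simp only [hk, Nat.even_add_one, this, derivative_C_mul, hg, if_true, if_false,
      not_false_eq_true,
      pow_succ, C_mul]
    ring

theorem exists_iterate_derivative_eq (i : ℕ) : ∃ u : ℕ → ℂ[X], u i = 1 ∧ (∀ k, i < k → u k = 0) ∧
    ∀ (c : ℂ) (g : ℂ[X]), derivative (derivative g) = 2 * X * derivative g + C c * g →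
      derivative^[i] g = ∑ k ∈ Finset.range (i + 1), u k * eigenJet c g (derivative g) k := by
  induction i with
  | zero =>
    refine ⟨fun k => if k = 0 then 1 else 0, by simp, fun k hk => by simp [hk.ne'], ?_⟩
    intro c g _
    simp [eigenJet]
  | succ i ih =>
    obtain ⟨u, h1, h0, h⟩ := ih
    refine ⟨fun k => derivative (u k) + (if k = 0 then 0 else u (k - 1)) +
      if Even k then 0 else 2 * X * u k, ?_, ?_, ?_⟩
    · simp [h0 (i + 1) (Nat.lt_succ_self i), h1]
    · intro k hk
      have h2 : k ≠ 0 := by omega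
      simp [h0 k (by omega), h0 (k - 1) (by omega), h2]
    · intro c g hg
      rw [Function.iterate_succ_apply', h c g hg]
      simp only [derivative_sum, derivative_mul, derivative_eigenJet hg, add_mul, mul_add,
        Finset.sum_add_distrib]
      have s1 : ∑ k ∈ Finset.range (i + 1 + 1), (if k = 0 then 0 else u (k - 1)) *
          eigenJet c g (derivative g) k =
          ∑ k ∈ Finset.range (i + 1), u k * eigenJet c g (derivative g) (k + 1) := by
        rw [Finset.sum_range_succ']; simp
      rw [s1, Finset.sum_range_succ _ (i + 1), Finset.sum_range_succ _ (i + 1)]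
      simp only [h0 (i + 1) (Nat.lt_succ_self i), derivative_zero, zero_mul, mul_zero, ite_self,
        add_zero, add_assoc]
      congr 2
      refine Finset.sum_congr rfl fun k _ => ?_
      split_ifs <;> ring

/-- The passage from `eigenJet` to the derivatives is unitriangular, with the same matrix for
all eigenfunctions and all eigenvalues. -/
theorem exists_unitriangular : ∃ U : ℕ → ℕ → ℂ[X], (∀ i, U i i = 1) ∧
    ∀ (c : ℂ) (g : ℂ[X]), derivative (derivative g) = 2 * X * derivative g + C c * g → ∀ i,
      derivative^[i] g =
        ∑ k ∈ Finset.range (i + 1), U i k * eigenJet c g (derivative g) k := by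
  choose u h1 _ h using exists_iterate_derivative_eq
  exact ⟨u, h1, fun c g hg i => h i c g hg⟩

theorem wr_eq_det_eigenJet {n : ℕ} (c : Fin n → ℂ) (g : Fin n → ℂ[X])
    (hg : ∀ j, derivative (derivative (g j)) = 2 * X * derivative (g j) + C (c j) * g j) :
    wr (fun p => derivative p) g =
      (Matrix.of fun i j : Fin n => eigenJet (c j) (g j) (derivative (g j)) i).det := by
  obtain ⟨U, h1, h⟩ := exists_unitriangular
  exact det_of_unitriangular_rows U h1 (fun j => eigenJet (c j) (g j) (derivative (g j)))
    (fun j i => derivative^[i] (g j)) fun j i => h _ _ (hg j) i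

/-- Lagrange interpolation in the eigenvalue: the first `m + 2` entries of `eigenJet μ a b`
have degree at most `(m + 1) / 2 ≤ m` in `μ`. -/
theorem eigenJet_eq_sum_basis {m : ℕ} {c : Fin (m + 1) → ℂ} (hc : Function.Injective c) (μ : ℂ)
    (a b : ℂ[X]) {i : ℕ} (hi : i < m + 2) :
    eigenJet μ a b i =
      ∑ j, C ((Lagrange.basis Finset.univ c j).eval μ) * eigenJet (c j) a b i := by
  have hd : ((X : ℂ[X]) ^ (i / 2)).degree < (Finset.univ : Finset (Fin (m + 1))).card := by
    rw [degree_X_pow, Finset.card_univ, Fintype.card_fin]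
    exact_mod_cast (by omega : i / 2 < m + 1)
  have e := congrArg (eval μ) (Lagrange.eq_interpolate hc.injOn hd)
  simp only [Lagrange.interpolate_apply, eval_pow, eval_X, eval_finsetSum, eval_mul, eval_C] at e
  unfold eigenJet
  rw [e]
  simp only [map_sum, C_mul, Finset.sum_mul]
  refine Finset.sum_congr rfl fun j _ => ?_
  ring

/-- If the last column belongs to the same eigenvalue as column `j`, the determinant factors:
after subtracting `c j` times row `i` from row `i + 2`, both columns vanish below the first two
rows, and the other columns acquire the factors `c s - c j`. -/
theorem det_eigenJet_snoc_self {m : ℕ} (c : Fin (m + 1) → ℂ) (g : Fin (m + 1) → ℂ[X])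
    (hg : ∀ j, derivative (derivative (g j)) = 2 * X * derivative (g j) + C (c j) * g j)
    (j : Fin (m + 1)) (a b : ℂ[X]) :
    (Matrix.of fun i s : Fin (m + 2) => Fin.snoc (α := fun _ => ℕ → ℂ[X])
      (fun s => eigenJet (c s) (g s) (derivative (g s))) (eigenJet (c j) a b) s i).det =
      (-1) ^ (j : ℕ) * C (∏ s, (c j - c (j.succAbove s))) *
        wr (fun p => derivative p) (fun s : Fin m => g (j.succAbove s)) *
          (g j * b - derivative (g j) * a) := by
  -- The columns after the row operation.
  set red : ℂ → ℂ[X] → ℂ[X] → ℕ → ℂ[X] := fun d a b i =>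
    match i with
    | 0 => a
    | 1 => b
    | i + 2 => C (d - c j) * eigenJet d a b i with hred
  have key : ∀ d a b i, red d a b i = ∑ k ∈ Finset.range (i + 1),
      (if k = i then 1 else if k + 2 = i then - C (c j) else 0) * eigenJet d a b k := by
    intro d a b i
    match i with
    | 0 => simp [hred, eigenJet]
    | 1 => simp [hred, eigenJet, Finset.sum_range_succ]
    | i + 2 =>
      rw [Finset.sum_range_succ, Finset.sum_range_succ, Finset.sum_range_succ,
        Finset.sum_eq_zero]
      · have : (i + 2) / 2 = i / 2 + 1 := by omega
        by_cases hi : Even i <;>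
          simp [hred, eigenJet, this, hi, pow_succ, Nat.even_add_one] <;> ring
      · intro k hk
        have := Finset.mem_range.1 hk
        rw [if_neg (by omega), if_neg (by omega), zero_mul]
  rw [← det_of_unitriangular_rows
    (fun i k => if k = i then 1 else if k + 2 = i then - C (c j) else 0) (by simp) _
    (fun s => Fin.snoc (α := fun _ => ℕ → ℂ[X])
      (fun s => red (c s) (g s) (derivative (g s))) (red (c j) a b) s) (by
      intro s i
      induction s using Fin.lastCases with
      | last => simp only [Fin.snoc_last]; exact key _ _ _ _
      | cast s => simp only [Fin.snoc_castSucc]; exact key _ _ _ _), det_snoc_column]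
  rw [Fin.sum_univ_succ, Fin.sum_univ_succ, Finset.sum_eq_zero (by
    intro i _
    simp [hred]), add_zero]
  have minor : ∀ M : Matrix (Fin (m + 1)) (Fin (m + 1)) ℂ[X],
      (∀ i : Fin m, ∀ s, M i.succ s = red (c s) (g s) (derivative (g s)) (i + 2)) →
      M.det = (-1) ^ (j : ℕ) * M 0 j * (∏ s, C (c (j.succAbove s) - c j)) *
        wr (fun p => derivative p) (fun s : Fin m => g (j.succAbove s)) := by
    intro M hM
    rw [det_eq_of_column M j (by intro i; simp [hM, hred]), mul_assoc _ (Finset.prod _ _),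
      wr_eq_det_eigenJet (fun s => c (j.succAbove s)) _ (fun s => hg _), ← Matrix.det_mul_row]
    congr 2
    ext i s
    simp [hM, hred]
  rw [minor _ (by intro i s; simp), minor _ (by
    intro i s
    simp [Fin.succAbove, Fin.lt_def])]
  have e : ∏ s, C (c (j.succAbove s) - c j) = (-1) ^ m * C (∏ s, (c j - c (j.succAbove s))) := by
    have := Finset.prod_neg (s := Finset.univ) fun s => C (c j - c (j.succAbove s))
    simpa using this
  have e2 : ((-1 : ℂ[X]) ^ m) * (-1) ^ m = 1 := by rw [← mul_pow]; simp
  rw [e]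
  simp only [hred, Matrix.of_apply, Fin.zero_succAbove, Fin.succ_succAbove_zero, Fin.val_zero,
    Fin.val_succ, pow_succ, pow_add, pow_zero]
  linear_combination ((-1) ^ (j : ℕ) * C (∏ s, (c j - c (j.succAbove s))) *
        wr (fun p => derivative p) (fun s : Fin m => g (j.succAbove s)) *
          (g j * b - derivative (g j) * a)) * e2

theorem basis_eval_mul_prod {m : ℕ} {c : Fin (m + 1) → ℂ} (hc : Function.Injective c) (μ : ℂ)
    (j : Fin (m + 1)) :
    (Lagrange.basis Finset.univ c j).eval μ * ∏ s, (c j - c (j.succAbove s)) =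
      ∏ s, (μ - c (j.succAbove s)) := by
  have : (Finset.univ.erase j) = Finset.univ.map j.succAboveEmb := by
    ext i
    simp [Fin.exists_succAbove_eq_iff]
  rw [Lagrange.basis, this, Finset.prod_map, eval_prod, ← Finset.prod_mul_distrib]
  refine Finset.prod_congr rfl fun s _ => ?_
  have h : c j - c (j.succAbove s) ≠ 0 :=
    sub_ne_zero.2 fun h => j.succAbove_ne s (hc h).symm
  simp [Lagrange.basisDivisor]
  field_simp

/-- The Wronskian `Wr[g₁, …, g_ℓ, y]` of eigenfunctions as a combination of the products of the
two-term Wronskians `Wr[gⱼ, y]` with the Wronskians that omit `gⱼ`. The coefficients are, up to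
sign, the products of the differences of `μ` and the eigenvalues other than the `j`-th. -/
theorem wr_snoc_eq_sum {m : ℕ} {c : Fin (m + 1) → ℂ} (hc : Function.Injective c)
    (g : Fin (m + 1) → ℂ[X])
    (hg : ∀ j, derivative (derivative (g j)) = 2 * X * derivative (g j) + C (c j) * g j)
    {μ : ℂ} {y : ℂ[X]} (hy : derivative (derivative y) = 2 * X * derivative y + C μ * y) :
    wr (fun p => derivative p) (Fin.snoc (α := fun _ => ℂ[X]) g y) =
      ∑ j : Fin (m + 1), (-1) ^ (j : ℕ) * C (∏ s, (μ - c (j.succAbove s))) *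
        wr (fun p => derivative p) (fun s : Fin m => g (j.succAbove s)) *
          (g j * derivative y - derivative (g j) * y) := by
  obtain ⟨U, h1, h⟩ := exists_unitriangular
  have e : wr (fun p => derivative p) (Fin.snoc (α := fun _ => ℂ[X]) g y) =
      (Matrix.of fun i s : Fin (m + 2) => Fin.snoc (α := fun _ => ℕ → ℂ[X])
      (fun s => eigenJet (c s) (g s) (derivative (g s))) (eigenJet μ y (derivative y)) s i).det :=
    det_of_unitriangular_rows U h1 _
      (fun s i => derivative^[i] (Fin.snoc (α := fun _ => ℂ[X]) g y s)) (by
        intro s i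
        induction s using Fin.lastCases with
        | last => simp only [Fin.snoc_last]; exact h _ _ hy i
        | cast s => simp only [Fin.snoc_castSucc]; exact h _ _ (hg s) i)
  rw [e, det_snoc_column]
  simp only [eigenJet_eq_sum_basis hc μ y (derivative y) (Fin.is_lt _), Finset.mul_sum,
    Finset.sum_mul]
  rw [Finset.sum_comm]
  refine Finset.sum_congr rfl fun j _ => ?_
  rw [← basis_eval_mul_prod hc μ j, C_mul]
  have := det_eigenJet_snoc_self c g hg j y (derivative y)
  rw [det_snoc_column] at this
  trans C ((Lagrange.basis Finset.univ c j).eval μ) *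
     ((-1) ^ (j : ℕ) * C (∏ s, (c j - c (j.succAbove s))) *
        wr (fun p => derivative p) (fun s : Fin m => g (j.succAbove s)) *
          (g j * derivative y - derivative (g j) * y))
  · rw [← this, Finset.mul_sum]
    refine Finset.sum_congr rfl fun i _ => ?_
    ring
  · ring

end Eigenfunctions

/-! ### The functions `h̃ⱼ` and the composition `B ∘ A` -/

section Duality

/-- The Wronskian of the tuple `v` with `v j` omitted. -/
def wrOmit {m : ℕ} (v : Fin (m + 1) → ℂ[X]) (j : Fin (m + 1)) : ℂ[X] :=
  wr (fun p => derivative p) fun s : Fin m => v (j.succAbove s)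

/-- The sum `∑ⱼ ± ṽⱼ⁽ⁱ⁾ vⱼ⁽ᵏ⁾`, where `ṽⱼ` is the Wronskian omitting `vⱼ`. The signs are those of
the expansion of a Wronskian along its last row, so that `(± ṽⱼ)ⱼ` is, up to the factor `Wr[v]`,
the system dual to `v`. -/
def pairing {m : ℕ} (v : Fin (m + 1) → ℂ[X]) (i k : ℕ) : ℂ[X] :=
  ∑ j : Fin (m + 1), (-1) ^ ((j : ℕ) + m) * derivative^[i] (wrOmit v j) * derivative^[k] (v j)

/-- `pairing v 0 k` expands the Wronskian with its last row replaced by the `k`-th derivatives. -/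
theorem pairing_zero_eq_det {m : ℕ} (v : Fin (m + 1) → ℂ[X]) (k : ℕ) :
    pairing v 0 k = (Matrix.of fun i j : Fin (m + 1) =>
      derivative^[if i = Fin.last m then k else i] (v j)).det := by
  rw [Matrix.det_succ_row _ (Fin.last m)]
  refine Finset.sum_congr rfl fun j _ => ?_
  have : wrOmit v j = ((Matrix.of fun i j : Fin (m + 1) =>
      derivative^[if i = Fin.last m then k else i] (v j)).submatrix (Fin.last m).succAbove
        j.succAbove).det := by
    unfold wrOmit wr
    congr 1
    ext r s : 2
    simp [(Fin.castSucc_lt_last r).ne]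
  rw [← this]
  simp only [Function.iterate_zero, id, Matrix.of_apply, if_true, Fin.val_last, add_comm (j : ℕ)]
  ring

theorem pairing_zero_of_lt {m : ℕ} (v : Fin (m + 1) → ℂ[X]) {k : ℕ} (hk : k < m) :
    pairing v 0 k = 0 := by
  rw [pairing_zero_eq_det]
  refine Matrix.det_zero_of_row_eq (i := Fin.last m) (j := ⟨k, by omega⟩) ?_ ?_
  · simp only [ne_eq, Fin.ext_iff, Fin.val_last]; omega
  · ext s : 1
    simp [Fin.ext_iff, hk.ne]

theorem pairing_zero_self {m : ℕ} (v : Fin (m + 1) → ℂ[X]) :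
    pairing v 0 m = wr (fun p => derivative p) v := by
  rw [pairing_zero_eq_det]
  unfold wr
  congr 1
  ext i j : 2
  simp only [Matrix.of_apply]
  split_ifs with h
  · simp [h]
  · rfl

theorem pairing_succ {m : ℕ} (v : Fin (m + 1) → ℂ[X]) (i k : ℕ) :
    pairing v (i + 1) k = derivative (pairing v i k) - pairing v i (k + 1) := by
  unfold pairing
  rw [derivative_sum, ← Finset.sum_sub_distrib]
  refine Finset.sum_congr rfl fun j _ => ?_
  have : derivative ((-1 : ℂ[X]) ^ ((j : ℕ) + m)) = 0 := by
    rw [show (-1 : ℂ[X]) = C (-1) by simp, ← C_pow, derivative_C]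
  simp only [derivative_mul, Function.iterate_succ_apply', this]
  ring

theorem pairing_of_add_lt {m : ℕ} (v : Fin (m + 1) → ℂ[X]) (i : ℕ) :
    ∀ k, i + k < m → pairing v i k = 0 := by
  induction i with
  | zero => intro k hk; exact pairing_zero_of_lt v (by omega)
  | succ i ih =>
    intro k hk
    rw [pairing_succ, ih k (by omega), ih (k + 1) (by omega)]
    simp

theorem pairing_of_add_eq {m : ℕ} (v : Fin (m + 1) → ℂ[X]) (i : ℕ) :
    ∀ k, i + k = m → pairing v i k = (-1) ^ i * wr (fun p => derivative p) v := by
  induction i with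
  | zero =>
    intro k hk
    obtain rfl : k = m := by omega
    simp [pairing_zero_self]
  | succ i ih =>
    intro k hk
    rw [pairing_succ, pairing_of_add_lt v i k (by omega), ih (k + 1) (by omega)]
    simp [pow_succ]

/-- The Wronskian of the omitted Wronskians, in a form that needs no division. The matrix of
the pairings is triangular once the order of its columns is reversed. -/
theorem wr_wrOmit_mul {m : ℕ} (v : Fin (m + 1) → ℂ[X]) :
    wr (fun p => derivative p) (wrOmit v) * wr (fun p => derivative p) v =
      (-1) ^ ((m + 1) / 2) * wr (fun p => derivative p) v ^ (m + 1) := by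
  set η := wr (fun p => derivative p) v with hη
  set P : Matrix (Fin (m + 1)) (Fin (m + 1)) ℂ[X] :=
    Matrix.of fun i j => (-1) ^ ((j : ℕ) + m) * derivative^[i] (wrOmit v j) with hP
  set Q : Matrix (Fin (m + 1)) (Fin (m + 1)) ℂ[X] :=
    Matrix.of fun j k => derivative^[(Fin.rev k : ℕ)] (v j) with hQ
  have hPQ : ∀ i k, (P * Q) i k = pairing v i (Fin.rev k) := by
    intro i k
    simp [P, Q, Matrix.mul_apply, pairing]
  have d1 : (P * Q).det = (-1) ^ ((m + 1) / 2) * η ^ (m + 1) := by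
    rw [Matrix.det_of_isLowerTriangular]
    · rw [← prod_neg_one_pow_fin]
      have : ∀ i : Fin (m + 1), (P * Q) i i = (-1) ^ (i : ℕ) * η := by
        intro i
        rw [hPQ, pairing_of_add_eq]
        rw [Fin.val_rev]; omega
      simp only [this, Finset.prod_mul_distrib]
      simp
    · intro i k hik
      have : (i : ℕ) < k := hik
      rw [hPQ, pairing_of_add_lt]
      rw [Fin.val_rev]; omega
  have d2 : P.det = (-1) ^ ((m + 1) / 2) * wr (fun p => derivative p) (wrOmit v) := by
    have := Matrix.det_mul_row (fun j : Fin (m + 1) => (-1 : ℂ[X]) ^ ((j : ℕ) + m))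
      (Matrix.of fun i j => derivative^[(i : ℕ)] (wrOmit v j))
    refine this.trans ?_
    congr 1
    simp only [pow_add, Finset.prod_mul_distrib, prod_neg_one_pow_fin]
    simp [← pow_mul, (Nat.even_mul_succ_self m).neg_one_pow]
  have d3 : Q.det = (-1) ^ ((m + 1) / 2) * η := by
    rw [← Matrix.det_transpose, ← sign_revPerm]
    exact Matrix.det_permute (Fin.revPerm : Equiv.Perm (Fin (m + 1)))
      (Matrix.of fun i j : Fin (m + 1) => derivative^[(i : ℕ)] (v j))
  rw [Matrix.det_mul, d2, d3] at d1
  have e2 : ((-1 : ℂ[X]) ^ ((m + 1) / 2)) * (-1) ^ ((m + 1) / 2) = 1 := by rw [← mul_pow]; simp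
  linear_combination d1 - wr (fun p => derivative p) (wrOmit v) * η * e2

/-- `p' - 2 x p`, the derivative conjugated by `e^{-x²}`. -/
def gaussDerivative (p : ℂ[X]) : ℂ[X] := derivative p - 2 * X * p

/-- The polynomial `e^{x²} Wr[v₁, …, v_m, e^{-x²} p]`: derivatives of the last entry are taken by
`gaussDerivative`. -/
def wrGauss {m : ℕ} (v : Fin m → ℂ[X]) (p : ℂ[X]) : ℂ[X] :=
  (Matrix.of fun i j : Fin (m + 1) => Fin.snoc (α := fun _ => ℕ → ℂ[X])
    (fun j i => derivative^[i] (v j)) (fun i => gaussDerivative^[i] p) j i).det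

theorem gaussDerivative_wronskian {c μ : ℂ} {g y : ℂ[X]}
    (hg : derivative (derivative g) = 2 * X * derivative g + C c * g)
    (hy : derivative (derivative y) = 2 * X * derivative y + C μ * y) :
    gaussDerivative (g * derivative y - derivative g * y) = C (μ - c) * (g * y) := by
  simp only [gaussDerivative, derivative_sub, derivative_mul, hg, hy, C_sub]
  ring

/-- The composition of the two Wronskian operators acts on eigenfunctions as a scalar, up to the
factor `Wr[g̃] Wr[g]`. By `wr_snoc_eq_sum` the last column is a combination of the preceding ones in
all rows but the last; the relations `pairing_of_add_lt` keep this shape under differentiation. -/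
theorem wrGauss_wr_snoc {m : ℕ} {c : Fin (m + 1) → ℂ} (hc : Function.Injective c)
    (g : Fin (m + 1) → ℂ[X])
    (hg : ∀ j, derivative (derivative (g j)) = 2 * X * derivative (g j) + C (c j) * g j)
    {μ : ℂ} {y : ℂ[X]} (hy : derivative (derivative y) = 2 * X * derivative y + C μ * y) :
    wrGauss (wrOmit g) (wr (fun p => derivative p) (Fin.snoc (α := fun _ => ℂ[X]) g y)) =
      C (∏ j, (μ - c j)) * y * (wr (fun p => derivative p) (wrOmit g) *
        wr (fun p => derivative p) g) := by
  set e : Fin (m + 1) → ℂ := fun j => (-1) ^ (j : ℕ) * ∏ s, (μ - c (j.succAbove s)) with he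
  set w : Fin (m + 1) → ℂ[X] := fun j => g j * derivative y - derivative (g j) * y with hw
  set η := wr (fun p => derivative p) g with hη
  have hA : wr (fun p => derivative p) (Fin.snoc (α := fun _ => ℂ[X]) g y) =
      ∑ j : Fin (m + 1), C (e j) * w j * wrOmit g j := by
    rw [wr_snoc_eq_sum hc g hg hy]
    refine Finset.sum_congr rfl fun j _ => ?_
    simp only [he, hw, wrOmit, C_mul, C_pow, C_neg, C_1]
    ring
  have step : ∀ i, gaussDerivative (∑ j, C (e j) * w j * derivative^[i] (wrOmit g j)) =
      ∑ j, C (e j) * w j * derivative^[i + 1] (wrOmit g j) +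
        (-1) ^ m * (C (∏ j, (μ - c j)) * y * pairing g i 0) := by
    intro i
    have : gaussDerivative (∑ j, C (e j) * w j * derivative^[i] (wrOmit g j)) =
        ∑ j, (C (e j) * w j * derivative^[i + 1] (wrOmit g j) +
          C (e j) * gaussDerivative (w j) * derivative^[i] (wrOmit g j)) := by
      simp only [gaussDerivative, derivative_sum, Finset.mul_sum, ← Finset.sum_sub_distrib]
      refine Finset.sum_congr rfl fun j _ => ?_
      simp only [derivative_mul, derivative_C, Function.iterate_succ_apply']
      ring
    rw [this, Finset.sum_add_distrib]
    congr 1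
    rw [pairing, Finset.mul_sum, Finset.mul_sum]
    refine Finset.sum_congr rfl fun j _ => ?_
    have e2 : ((-1 : ℂ[X]) ^ m) * (-1) ^ m = 1 := by rw [← mul_pow]; simp
    rw [hw, gaussDerivative_wronskian (hg j) hy, he, Fin.prod_univ_succAbove _ j]
    simp only [C_mul, C_pow, C_neg, C_1, Function.iterate_zero, id, pow_add]
    linear_combination (-((-1) ^ (j : ℕ)) * C (∏ s, (μ - c (j.succAbove s))) * C (μ - c j) *
      derivative^[i] (wrOmit g j) * g j * y) * e2
  have iter : ∀ i, i ≤ m → gaussDerivative^[i] (∑ j : Fin (m + 1), C (e j) * w j * wrOmit g j) =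
      ∑ j, C (e j) * w j * derivative^[i] (wrOmit g j) := by
    intro i
    induction i with
    | zero => intro _; simp
    | succ i ih =>
      intro hi
      rw [Function.iterate_succ_apply', ih (by omega), step, pairing_of_add_lt g i 0 (by omega)]
      simp
  have iter' : ∀ i : Fin (m + 2),
      gaussDerivative^[i] (∑ j : Fin (m + 1), C (e j) * w j * wrOmit g j) =
      ∑ j, C (e j) * w j * derivative^[i] (wrOmit g j) +
        if i = Fin.last (m + 1) then C (∏ j, (μ - c j)) * y * η else 0 := by
    intro i
    induction i using Fin.lastCases with
    | last =>
      have e2 : ((-1 : ℂ[X]) ^ m) * (-1) ^ m = 1 := by rw [← mul_pow]; simp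
      rw [Fin.val_last, Function.iterate_succ_apply', iter m le_rfl, step,
        pairing_of_add_eq g m 0 (by omega), if_pos rfl]
      linear_combination (C (∏ j, (μ - c j)) * y * η) * e2
    | cast i =>
      rw [if_neg (Fin.castSucc_lt_last i).ne, add_zero, Fin.val_castSucc, iter i (by omega)]
  -- Replacing the last column by a copy of column `j` gives zero.
  have rep : ∀ j : Fin (m + 1), ∑ i : Fin (m + 2), (-1) ^ ((i : ℕ) + (m + 1)) *
      derivative^[i] (wrOmit g j) * (Matrix.of fun r s : Fin (m + 1) =>
        derivative^[(i.succAbove r : ℕ)] (wrOmit g s)).det = 0 := by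
    intro j
    rw [← det_snoc_column (fun s i => derivative^[i] (wrOmit g s))
      (fun i => derivative^[i] (wrOmit g j))]
    exact Matrix.det_zero_of_column_eq (i := j.castSucc) (j := Fin.last _)
      (Fin.castSucc_lt_last j).ne (by intro i; simp)
  rw [hA, wrGauss, det_snoc_column]
  simp only [iter', mul_add, add_mul, Finset.sum_add_distrib, mul_ite, ite_mul, mul_zero, zero_mul,
    Finset.sum_ite_eq', Finset.mem_univ, if_true]
  have z : ∑ i : Fin (m + 2), (-1) ^ ((i : ℕ) + (m + 1)) *
      (∑ j, C (e j) * w j * derivative^[i] (wrOmit g j)) * (Matrix.of fun r s : Fin (m + 1) =>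
        derivative^[(i.succAbove r : ℕ)] (wrOmit g s)).det = 0 := by
    simp only [Finset.mul_sum, Finset.sum_mul]
    rw [Finset.sum_comm]
    refine Finset.sum_eq_zero fun j _ => ?_
    rw [← mul_zero (C (e j) * w j), ← rep j, Finset.mul_sum]
    refine Finset.sum_congr rfl fun i _ => ?_
    ring
  rw [z, zero_add]
  have l : (Matrix.of fun r s : Fin (m + 1) =>
      derivative^[((Fin.last (m + 1)).succAbove r : ℕ)] (wrOmit g s)).det =
      wr (fun p => derivative p) (wrOmit g) := by
    simp [wr]
  have e2 : ((-1 : ℂ[X]) ^ (m + 1)) * (-1) ^ (m + 1) = 1 := by rw [← mul_pow]; simp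
  rw [l, Fin.val_last, pow_add, e2]
  ring

end Duality

/-! ### Wronskians of polynomials of distinct degrees -/

section Nonvanishing

/-- The leading coefficient of the Wronskian is a Vandermonde determinant in the degrees, up to
the leading coefficients of the entries. -/
theorem wr_ne_zero_of_natDegree_injective {n : ℕ} (v : Fin n → ℂ[X]) (hv : ∀ j, v j ≠ 0)
    (hinj : Function.Injective fun j => (v j).natDegree) : wr (fun p => derivative p) v ≠ 0 := by
  intro h0
  obtain ⟨K, hK⟩ : ∃ K, ∀ j, (v j).natDegree ≤ K :=
    ⟨Finset.univ.sup fun j => (v j).natDegree,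
      fun j => Finset.le_sup (f := fun j => (v j).natDegree) (Finset.mem_univ j)⟩
  -- Powers of `X` in rows and columns bring all entries to the same degree bound `K`, without
  -- subtraction of degrees.
  set M : Matrix (Fin n) (Fin n) ℂ[X] := Matrix.of fun i j =>
    X ^ (K - (v j).natDegree) * (X ^ (i : ℕ) * derivative^[i] (v j)) with hM
  have hM0 : M.det = 0 := by
    have e1 := Matrix.det_mul_row (fun j : Fin n => (X : ℂ[X]) ^ (K - (v j).natDegree))
      (Matrix.of fun i j => X ^ (i : ℕ) * derivative^[i] (v j))
    have e2 := Matrix.det_mul_column (fun i : Fin n => (X : ℂ[X]) ^ (i : ℕ))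
      (Matrix.of fun i j => derivative^[i] (v j))
    have e3 : (Matrix.of fun i j : Fin n => derivative^[i] (v j)).det = 0 := h0
    simp only [Matrix.of_apply] at e1 e2
    rw [hM, e1, e2, e3]
    simp
  have hdeg : ∀ i j, (M i j).natDegree ≤ K := by
    intro i j
    refine (natDegree_mul_le.trans (add_le_add (natDegree_X_pow_le _)
      (?_ : _ ≤ (v j).natDegree))).trans
      (by have := hK j; omega)
    by_cases hi : (i : ℕ) ≤ (v j).natDegree
    · refine (natDegree_mul_le.trans (add_le_add (natDegree_X_pow_le _)
        (natDegree_iterate_derivative _ _))).trans (by omega)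
    · rw [iterate_derivative_eq_zero (by omega)]; simp
  have hcoeff : ∀ i j, (M i j).coeff K =
      (v j).leadingCoeff * ((v j).natDegree.descFactorial i : ℂ) := by
    intro i j
    obtain ⟨t, ht⟩ := Nat.exists_eq_add_of_le (hK j)
    have e : K - (v j).natDegree = t := by omega
    rw [hM, Matrix.of_apply, e, ht, coeff_X_pow_mul]
    by_cases hi : (i : ℕ) ≤ (v j).natDegree
    · obtain ⟨d, hd⟩ := Nat.exists_eq_add_of_le' hi
      rw [leadingCoeff, hd, coeff_X_pow_mul, coeff_iterate_derivative, nsmul_eq_mul, mul_comm]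
    · rw [iterate_derivative_eq_zero (by omega), Nat.descFactorial_of_lt (by omega)]
      simp
  have hc : M.det.coeff (n * K) = (Matrix.of fun i j => (M i j).coeff K).det := by
    rw [Matrix.det_apply, Matrix.det_apply, finsetSum_coeff]
    refine Finset.sum_congr rfl fun σ _ => ?_
    have := coeff_prod_of_natDegree_le (s := Finset.univ) (fun i => M (σ i) i) K
      (fun i _ => hdeg _ _)
    rw [Finset.card_univ, Fintype.card_fin] at this
    rw [coeff_smul, this]
    rfl
  rw [hM0, coeff_zero] at hc
  simp only [hcoeff] at hc
  have e4 := Matrix.det_mul_row (fun j : Fin n => (v j).leadingCoeff)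
      (Matrix.of fun i j => ((v j).natDegree.descFactorial i : ℂ))
  simp only [Matrix.of_apply] at e4
  rw [e4] at hc
  refine mul_ne_zero (Finset.prod_ne_zero_iff.2 fun j _ => leadingCoeff_ne_zero.2 (hv j)) ?_ hc.symm
  rw [← Matrix.det_transpose]
  have e5 := Matrix.det_eval_matrixOfPolynomials_eq_det_vandermonde
    (fun j : Fin n => ((v j).natDegree : ℂ)) (fun i => descPochhammer ℂ i)
    (fun i => descPochhammer_natDegree ℂ i) (fun i => monic_descPochhammer ℂ i)
  simp only [descPochhammer_eval_eq_descFactorial] at e5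
  refine ne_of_eq_of_ne e5.symm (Matrix.det_vandermonde_ne_zero_iff.2 fun a b hab => hinj ?_)
  exact_mod_cast hab

end Nonvanishing

/-! ### Hermite polynomials -/

section Hermite

theorem derivative_hermiteH_succ (n : ℕ) :
    derivative (hermiteH (n + 1)) = C (2 * (n + 1) : ℂ) * hermiteH n := by
  induction n with
  | zero => simp [hermiteH, C_ofNat]
  | succ n ih =>
    rw [hermiteH, derivative_sub, derivative_mul, ih]
    simp only [derivative_mul, derivative_C, derivative_ofNat, derivative_X, hermiteH, C_mul, C_add]
    push_cast
    simp only [C_add, C_1, C_ofNat, derivative_add, derivative_one, derivative_C]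
    ring

theorem derivative_derivative_hermiteH (n : ℕ) : derivative (derivative (hermiteH n)) =
    2 * X * derivative (hermiteH n) + C (-2 * n : ℂ) * hermiteH n := by
  cases n with
  | zero => simp [hermiteH]
  | succ n =>
    rw [derivative_hermiteH_succ, derivative_C_mul, hermiteH]
    push_cast
    simp only [C_mul, C_add, C_1, C_neg]
    ring

/-- Degree bound and leading coefficient `2ⁿ`, proved together. -/
theorem hermiteH_degree_aux (n : ℕ) :
    (hermiteH n).natDegree ≤ n ∧ (hermiteH n).coeff n = 2 ^ n := by
  induction n with
  | zero => simp [hermiteH]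
  | succ n ih =>
    have hd : (derivative (hermiteH n)).natDegree ≤ n :=
      (natDegree_derivative_le _).trans (by have := ih.1; omega)
    rw [hermiteH, show (2 : ℂ[X]) * X * hermiteH n = C 2 * hermiteH n * X by rw [C_ofNat]; ring]
    constructor
    · refine (natDegree_sub_le_of_le (?_ : _ ≤ n + 1) (hd.trans n.le_succ)).trans (max_self _).le
      exact natDegree_mul_le.trans (add_le_add ((natDegree_C_mul_le _ _).trans ih.1) natDegree_X_le)
    · rw [coeff_sub, coeff_mul_X, coeff_C_mul, ih.2, coeff_eq_zero_of_natDegree_lt (by omega)]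
      ring

theorem hermiteH_degree (n : ℕ) : (hermiteH n).degree = n := by
  obtain ⟨h1, h2⟩ := hermiteH_degree_aux n
  exact degree_eq_of_le_of_coeff_ne_zero (natDegree_le_iff_degree_le.1 h1) (by rw [h2]; simp)

/-- The Hermite polynomials as a sequence with one member in each degree. -/
def hermiteSequence : Polynomial.Sequence ℂ := ⟨hermiteH, hermiteH_degree⟩

theorem span_hermiteH : Submodule.span ℂ (Set.range hermiteH) = ⊤ :=
  hermiteSequence.span fun i => (leadingCoeff_ne_zero.2 (hermiteSequence.ne_zero i)).isUnit

end Hermite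

/-! ### The eigenvalues of `B ∘ A` on Hermite polynomials -/

section Factorization

theorem iterate_gaussDerivative_sum {ι : Type*} (s : Finset ι) (a : ι → ℂ) (p : ι → ℂ[X]) (i : ℕ) :
    gaussDerivative^[i] (∑ k ∈ s, C (a k) * p k) =
      ∑ k ∈ s, C (a k) * gaussDerivative^[i] (p k) := by
  induction i with
  | zero => rfl
  | succ i ih =>
    simp only [Function.iterate_succ_apply', ih, gaussDerivative, derivative_sum, Finset.mul_sum,
      ← Finset.sum_sub_distrib, derivative_C_mul]
    exact Finset.sum_congr rfl fun k _ => by ring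

theorem wrGauss_sum {m : ℕ} (v : Fin m → ℂ[X]) {ι : Type*} (s : Finset ι) (a : ι → ℂ)
    (p : ι → ℂ[X]) :
    wrGauss v (∑ k ∈ s, C (a k) * p k) = ∑ k ∈ s, C (a k) * wrGauss v (p k) := by
  simp only [wrGauss, det_snoc_column, iterate_gaussDerivative_sum, Finset.mul_sum, Finset.sum_mul]
  rw [Finset.sum_comm]
  exact Finset.sum_congr rfl fun k _ => Finset.sum_congr rfl fun i _ => by ring

variable {m : ℕ} {lam : Fin (m + 1) → ℕ}

theorem kk_injective (hmono : Monotone lam) : Function.Injective (kk lam) :=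
  StrictMono.injective fun _ _ h => add_lt_add_of_le_of_lt (hmono h.le) h

theorem eta_ne_zero (hmono : Monotone lam) : eta lam ≠ 0 := by
  refine wr_ne_zero_of_natDegree_injective _ (fun j => ?_) ?_
  · exact hermiteSequence.ne_zero (kk lam j)
  · have : (fun j => (hTuple lam j).natDegree) = kk lam :=
      funext fun j => hermiteSequence.natDegree_eq (kk lam j)
    rw [this]
    exact kk_injective hmono

/-- The value of `π` at `z`. -/
def piVal (lam : Fin (m + 1) → ℕ) (z : ℂ) : ℂ := ∏ i, (-2 * z + 2 * (kk lam i : ℂ))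

/-- `B (A Hₙ) = π(n) Hₙ`, with the denominator of `B` cleared. -/
theorem wrGauss_opAPoly_hermiteH (hmono : Monotone lam) (n : ℕ) :
    wrGauss (hTilde lam) (opAPoly lam (hermiteH n)) =
      (-1) ^ ((m + 1) / 2) * eta lam ^ (m + 1) * (C (piVal lam n) * hermiteH n) := by
  have hc : Function.Injective fun j => (-2 * (kk lam j : ℂ)) := by
    intro a b hab
    refine kk_injective hmono ?_
    have : (kk lam a : ℂ) = kk lam b := by simpa using hab
    exact_mod_cast this
  have h := wrGauss_wr_snoc hc (hTuple lam) (fun j => derivative_derivative_hermiteH (kk lam j))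
    (derivative_derivative_hermiteH n)
  rw [wr_wrOmit_mul] at h
  have e : ∏ j, (-2 * (n : ℂ) - -2 * (kk lam j : ℂ)) = piVal lam n :=
    Finset.prod_congr rfl fun j _ => by ring
  rw [e] at h
  refine h.trans ?_
  simp only [eta]
  ring

theorem opAPoly_zero : opAPoly lam 0 = 0 := by
  unfold opAPoly
  rw [wr_snoc]
  refine Finset.sum_eq_zero fun i _ => ?_
  have : (fun p : ℂ[X] => derivative p)^[i] 0 = 0 := iterate_derivative_zero
  rw [this]
  simp

theorem opAPoly_hermiteH_kk (i : Fin (m + 1)) : opAPoly lam (hermiteH (kk lam i)) = 0 := by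
  refine Matrix.det_zero_of_column_eq (i := i.castSucc) (j := Fin.last _)
    (Fin.castSucc_lt_last i).ne fun r => ?_
  simp [hTuple, hermiteZ]

end Factorization

/-! ### Polynomials as functions of a real variable -/

section PolynomialFunctions

/-- `polyFun` as a ring homomorphism. -/
def polyFunHom : ℂ[X] →+* (ℝ → ℂ) := RingHom.pi fun x : ℝ => evalRingHom (x : ℂ)

theorem polyFunHom_apply (p : ℂ[X]) : polyFunHom p = polyFun p := rfl

theorem polyFun_mul (p q : ℂ[X]) : polyFun (p * q) = polyFun p * polyFun q :=
  map_mul polyFunHom p q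

theorem hasDerivAt_polyFun (p : ℂ[X]) (x : ℝ) :
    HasDerivAt (polyFun p) (polyFun (derivative p) x) x :=
  (p.hasDerivAt (x : ℂ)).comp_ofReal

theorem deriv_polyFun (p : ℂ[X]) : deriv (polyFun p) = polyFun (derivative p) :=
  funext fun x => (hasDerivAt_polyFun p x).deriv

theorem iterate_deriv_polyFun (p : ℂ[X]) (i : ℕ) :
    deriv^[i] (polyFun p) = polyFun (derivative^[i] p) := by
  induction i with
  | zero => rfl
  | succ i ih => rw [Function.iterate_succ_apply', ih, deriv_polyFun, Function.iterate_succ_apply']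

theorem contDiff_polyFun (p : ℂ[X]) : ContDiff ℝ ∞ (polyFun p) := by
  have h : ContDiff ℂ ∞ fun z : ℂ => p.eval z := p.differentiable.contDiff
  exact (h.restrict_scalars ℝ).comp Complex.ofRealCLM.contDiff

theorem eq_of_polyFun_eq {d p q : ℂ[X]} (hd : d ≠ 0)
    (h : ∀ x, polyFun d x ≠ 0 → polyFun p x = polyFun q x) : p = q := by
  have h0 : d * (p - q) = 0 := by
    refine eq_zero_of_infinite_isRoot _ ((Set.infinite_range_of_injective
      Complex.ofReal_injective).mono ?_)
    rintro _ ⟨x, rfl⟩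
    by_cases hx : polyFun d x = 0
    · have hx' : eval (x : ℂ) d = 0 := hx
      simp [hx']
    · have hx' : eval (x : ℂ) p = eval (x : ℂ) q := h x hx
      simp [hx']
  exact sub_eq_zero.1 ((mul_eq_zero.1 h0).resolve_left hd)

theorem det_polyFun {n : ℕ} (M : Fin n → Fin n → ℂ[X]) :
    (Matrix.of fun i j => polyFun (M i j)).det = polyFun (Matrix.of M).det :=
  (RingHom.map_det polyFunHom (Matrix.of M)).symm

theorem wr_polyFun {n : ℕ} (v : Fin n → ℂ[X]) :
    wr deriv (fun j => polyFun (v j)) = polyFun (wr (fun p => derivative p) v) := by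
  unfold wr
  simp only [iterate_deriv_polyFun]
  exact det_polyFun _

theorem opA_polyFun {m : ℕ} (lam : Fin (m + 1) → ℕ) (p : ℂ[X]) :
    opA lam (polyFun p) = polyFun (opAPoly lam p) := by
  unfold opA opAPoly
  rw [← wr_polyFun]
  congr 1
  funext j
  induction j using Fin.lastCases <;> simp

end PolynomialFunctions

/-! ### Operators in `ℂ[x, ∂]` -/

namespace PolyDiffOp

/-- The action on polynomials. -/
def applyPoly (Q : PolyDiffOp) (p : ℂ[X]) : ℂ[X] := Q.sum fun j a => a * derivative^[j] p

theorem apply_polyFun (Q : PolyDiffOp) (p : ℂ[X]) :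
    Q.apply (polyFun p) = polyFun (Q.applyPoly p) := by
  funext x
  simp only [PolyDiffOp.apply, applyPoly, Finsupp.sum, iteratedDeriv_eq_iterate,
    iterate_deriv_polyFun]
  simp [polyFun, eval_finsetSum]

theorem apply_zero (y : ℝ → ℂ) : PolyDiffOp.apply 0 y = 0 := by
  funext x
  simp [PolyDiffOp.apply]

theorem apply_single (j : ℕ) (a : ℂ[X]) (y : ℝ → ℂ) :
    PolyDiffOp.apply (Finsupp.single j a) y = polyFun a * deriv^[j] y := by
  funext x
  rw [PolyDiffOp.apply, Finsupp.sum_single_index (by simp [polyFun]), iteratedDeriv_eq_iterate]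
  rfl

theorem apply_add (Q Q' : PolyDiffOp) (y : ℝ → ℂ) :
    PolyDiffOp.apply (Q + Q') y = Q.apply y + Q'.apply y := by
  funext x
  exact Finsupp.sum_add_index' (by simp [polyFun]) (by intros; simp [polyFun, add_mul])

theorem contDiff_apply (Q : PolyDiffOp) {y : ℝ → ℂ} (hy : ContDiff ℝ ∞ y) :
    ContDiff ℝ ∞ (Q.apply y) := by
  induction Q using Finsupp.induction_linear with
  | zero => rw [apply_zero]; exact contDiff_const
  | add Q Q' h h' => rw [apply_add]; exact h.add h'
  | single j a => rw [apply_single]; exact (contDiff_polyFun a).mul (hy.iterate_deriv j)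

theorem applyPoly_add (Q : PolyDiffOp) (p q : ℂ[X]) :
    Q.applyPoly (p + q) = Q.applyPoly p + Q.applyPoly q := by
  simp [applyPoly, Finsupp.sum, iterate_map_add, mul_add, Finset.sum_add_distrib]

theorem applyPoly_smul (Q : PolyDiffOp) (c : ℂ) (p : ℂ[X]) :
    Q.applyPoly (c • p) = c • Q.applyPoly p := by
  simp [applyPoly, Finsupp.sum, iterate_derivative_smul, Finset.smul_sum]

theorem applyPoly_zero (Q : PolyDiffOp) : Q.applyPoly 0 = 0 := by
  simp [applyPoly, Finsupp.sum]

theorem sub_applyPoly (Q Q' : PolyDiffOp) (p : ℂ[X]) :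
    applyPoly (Q - Q') p = Q.applyPoly p - Q'.applyPoly p :=
  Finsupp.sum_sub_index (by intros; ring)

/-- If all values of `Q` on polynomials are divisible by `d`, then so are the coefficients of
`Q`: they are recovered one after the other from the values at `1, X, X², …`. With `d = 0` this says
that `Q` is determined by its values on polynomials. -/
theorem dvd_coeff_of_dvd_applyPoly {Q : PolyDiffOp} {d : ℂ[X]}
    (h : ∀ p, d ∣ Q.applyPoly p) (j : ℕ) : d ∣ Q j := by
  induction j using Nat.strong_induction_on with
  | _ j ih =>
    have e : Q.applyPoly (X ^ j) = ∑ i ∈ Finset.range (j + 1), Q i * derivative^[i] (X ^ j) := by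
      refine Finset.sum_congr_of_eq_on_inter ?_ ?_ fun _ _ _ => rfl
      · intro i _ hi
        rw [Finset.mem_range] at hi
        beta_reduce
        rw [iterate_derivative_X_pow_eq_C_mul, Nat.descFactorial_of_lt (by omega)]
        simp
      · intro i _ hi
        simp only [Finsupp.notMem_support_iff.1 hi, zero_mul]
    rw [Finset.sum_range_succ] at e
    have h1 : d ∣ Q j * derivative^[j] (X ^ j) := by
      rw [← sub_eq_iff_eq_add'.2 e]
      exact dvd_sub (h _) (Finset.dvd_sum fun i hi => (ih i (Finset.mem_range.1 hi)).mul_right _)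
    rw [iterate_derivative_X_pow_eq_C_mul, Nat.sub_self, pow_zero, mul_one,
      Nat.descFactorial_self] at h1
    have hu : IsUnit (C ((j.factorial : ℕ) : ℂ)) :=
      isUnit_C.2 (IsUnit.mk0 _ (Nat.cast_ne_zero.2 j.factorial_ne_zero))
    exact hu.dvd_mul_right.1 h1

theorem exists_apply_eq_mul_of_dvd {R : PolyDiffOp} {d : ℂ[X]} (hd : d ≠ 0) (h : ∀ j, d ∣ R j) :
    ∃ Q : PolyDiffOp, ∀ y x, R.apply y x = polyFun d x * Q.apply y x := by
  refine ⟨R.mapRange (fun r => r / d) (by simp), fun y x => ?_⟩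
  have hR : R = (R.mapRange (fun r => r / d) (by simp)).mapRange (fun r => d * r) (by simp) := by
    ext1 j
    simp only [Finsupp.mapRange_apply]
    exact (EuclideanDomain.mul_div_cancel' hd (h j)).symm
  conv_lhs => rw [hR]
  unfold PolyDiffOp.apply
  rw [Finsupp.sum_mapRange_index (by simp [polyFun]), Finsupp.mul_sum]
  simp [polyFun, mul_assoc]

end PolyDiffOp

/-! ### Polynomial coefficients for `A` and for the numerator of `B ∘ f ∘ A` -/

section Operators

/-- On smooth functions, `F` acts as an element of `ℂ[x, ∂]`. -/
def IsPolyDiff (F : (ℝ → ℂ) → ℝ → ℂ) : Prop :=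
  ∃ Q : PolyDiffOp, ∀ y, ContDiff ℝ ∞ y → F y = Q.apply y

theorem IsPolyDiff.contDiff {F : (ℝ → ℂ) → ℝ → ℂ} (hF : IsPolyDiff F) {y : ℝ → ℂ}
    (hy : ContDiff ℝ ∞ y) : ContDiff ℝ ∞ (F y) := by
  obtain ⟨Q, hQ⟩ := hF
  rw [hQ y hy]
  exact Q.contDiff_apply hy

theorem isPolyDiff_single (j : ℕ) (a : ℂ[X]) : IsPolyDiff fun y => polyFun a * deriv^[j] y :=
  ⟨Finsupp.single j a, fun y _ => (PolyDiffOp.apply_single j a y).symm⟩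

theorem IsPolyDiff.add {F G : (ℝ → ℂ) → ℝ → ℂ} (hF : IsPolyDiff F) (hG : IsPolyDiff G) :
    IsPolyDiff fun y => F y + G y := by
  obtain ⟨Q, hQ⟩ := hF
  obtain ⟨Q', hQ'⟩ := hG
  exact ⟨Q + Q', fun y hy => by simp only [hQ y hy, hQ' y hy, PolyDiffOp.apply_add]⟩

theorem isPolyDiff_zero : IsPolyDiff fun _ => 0 :=
  ⟨0, fun y _ => (PolyDiffOp.apply_zero y).symm⟩

theorem isPolyDiff_sum {ι : Type*} (s : Finset ι) {F : ι → (ℝ → ℂ) → ℝ → ℂ}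
    (hF : ∀ i, IsPolyDiff (F i)) : IsPolyDiff fun y => ∑ i ∈ s, F i y := by
  classical
  induction s using Finset.induction_on with
  | empty => simpa using isPolyDiff_zero
  | insert i s hi ih => simpa [Finset.sum_insert hi] using (hF i).add ih

theorem IsPolyDiff.polyFun_mul {F : (ℝ → ℂ) → ℝ → ℂ} (hF : IsPolyDiff F) (a : ℂ[X]) :
    IsPolyDiff fun y => polyFun a * F y := by
  obtain ⟨Q, hQ⟩ := hF
  suffices h : IsPolyDiff fun y => polyFun a * Q.apply y by
    obtain ⟨Q', hQ'⟩ := h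
    exact ⟨Q', fun y hy => by simp only [hQ y hy, ← hQ' y hy]⟩
  clear hQ
  induction Q using Finsupp.induction_linear with
  | zero => simpa [PolyDiffOp.apply_zero] using isPolyDiff_zero
  | add Q Q' h h' => simpa [PolyDiffOp.apply_add, mul_add] using h.add h'
  | single j b =>
    have := isPolyDiff_single j (a * b)
    simpa [PolyDiffOp.apply_single, ← mul_assoc, ← polyFunHom_apply] using this

theorem IsPolyDiff.deriv {F : (ℝ → ℂ) → ℝ → ℂ} (hF : IsPolyDiff F) :
    IsPolyDiff fun y => deriv (F y) := by
  obtain ⟨Q, hQ⟩ := hF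
  suffices h : ∃ Q' : PolyDiffOp, ∀ y, ContDiff ℝ ∞ y → _root_.deriv (Q.apply y) = Q'.apply y by
    obtain ⟨Q', hQ'⟩ := h
    exact ⟨Q', fun y hy => by simp only [hQ y hy, ← hQ' y hy]⟩
  clear hQ
  have diff : ∀ (Q : PolyDiffOp) {y : ℝ → ℂ}, ContDiff ℝ ∞ y → Differentiable ℝ (Q.apply y) :=
    fun Q y hy => (Q.contDiff_apply hy).differentiable (by simp)
  induction Q using Finsupp.induction_linear with
  | zero => exact ⟨0, fun y _ => by rw [PolyDiffOp.apply_zero]; funext x; exact deriv_const x 0⟩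
  | add Q Q' h h' =>
    obtain ⟨P, hP⟩ := h
    obtain ⟨P', hP'⟩ := h'
    refine ⟨P + P', fun y hy => ?_⟩
    rw [PolyDiffOp.apply_add, PolyDiffOp.apply_add, ← hP y hy, ← hP' y hy]
    funext x
    exact deriv_add (diff Q hy x) (diff Q' hy x)
  | single j b =>
    refine ⟨Finsupp.single j (derivative b) + Finsupp.single (j + 1) b, fun y hy => ?_⟩
    rw [PolyDiffOp.apply_add, PolyDiffOp.apply_single, PolyDiffOp.apply_single,
      PolyDiffOp.apply_single, Function.iterate_succ_apply']
    funext x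
    have h1 := (hasDerivAt_polyFun b x).mul
      (((hy.iterate_deriv j).differentiable (by simp)) x).hasDerivAt
    exact h1.deriv

/-- `z' - 2 x z` for functions of a real variable, the counterpart of `gaussDerivative`. -/
def gaussDeriv (z : ℝ → ℂ) : ℝ → ℂ := deriv z + polyFun (-(2 * X)) * z

theorem iterate_gaussDeriv_polyFun (p : ℂ[X]) (i : ℕ) :
    gaussDeriv^[i] (polyFun p) = polyFun (gaussDerivative^[i] p) := by
  induction i with
  | zero => rfl
  | succ i ih =>
    rw [Function.iterate_succ_apply', ih, Function.iterate_succ_apply', gaussDeriv, deriv_polyFun,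
      gaussDerivative]
    simp only [← polyFunHom_apply, ← map_mul, ← map_add]
    congr 1
    ring

theorem IsPolyDiff.iterate_gaussDeriv {F : (ℝ → ℂ) → ℝ → ℂ} (hF : IsPolyDiff F) (i : ℕ) :
    IsPolyDiff fun y => gaussDeriv^[i] (F y) := by
  induction i with
  | zero => exact hF
  | succ i ih =>
    simp only [Function.iterate_succ_apply', gaussDeriv]
    exact ih.deriv.add (ih.polyFun_mul _)

theorem iterate_deriv_exp_mul {z : ℝ → ℂ} (hz : ContDiff ℝ ∞ z) (i : ℕ) :
    deriv^[i] (fun t : ℝ => Complex.exp (-(t : ℂ) ^ 2) * z t) =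
      fun t : ℝ => Complex.exp (-(t : ℂ) ^ 2) * gaussDeriv^[i] z t := by
  induction i with
  | zero => rfl
  | succ i ih =>
    rw [Function.iterate_succ_apply', ih, Function.iterate_succ_apply']
    have hs : ContDiff ℝ ∞ (gaussDeriv^[i] z) :=
      (IsPolyDiff.iterate_gaussDeriv (F := fun y => y)
        (by simpa [← polyFunHom_apply] using isPolyDiff_single 0 1) i).contDiff hz
    funext x
    have h1 : HasDerivAt (fun t : ℝ => Complex.exp (-(t : ℂ) ^ 2))
        (Complex.exp (-(x : ℂ) ^ 2) * (-(2 * x))) x := by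
      have : HasDerivAt (fun t : ℂ => Complex.exp (-t ^ 2))
          (Complex.exp (-(x : ℂ) ^ 2) * (-(2 * x))) (x : ℂ) := by
        have := ((hasDerivAt_pow 2 (x : ℂ)).neg).cexp
        simpa using this
      exact this.comp_ofReal
    have h2 := h1.mul ((hs.differentiable (by simp)) x).hasDerivAt
    refine h2.deriv.trans ?_
    simp only [gaussDeriv, polyFun, Pi.add_apply, Pi.mul_apply, eval_neg, eval_mul, eval_X,
      eval_ofNat]
    ring

variable {m : ℕ} (lam : Fin (m + 1) → ℕ)

theorem isPolyDiff_opA : IsPolyDiff (opA lam) := by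
  have : opA lam = fun y => ∑ i : Fin (m + 2), polyFun ((-1) ^ ((i : ℕ) + (m + 1)) *
      (Matrix.of fun r s : Fin (m + 1) => derivative^[(i.succAbove r : ℕ)] (hTuple lam s)).det) *
        deriv^[i] y := by
    funext y
    rw [opA, wr_snoc]
    refine Finset.sum_congr rfl fun i _ => ?_
    simp only [iterate_deriv_polyFun, det_polyFun]
    simp only [← polyFunHom_apply, map_mul, map_pow, map_neg, map_one]
    ring
  rw [this]
  exact isPolyDiff_sum _ fun i => isPolyDiff_single _ _

/-- The numerator of `B z`: the expansion of `e^{x²} Wr[h̃₁, …, h̃_ℓ, e^{-x²} z]` along its last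
column, with the exponentials cancelled. -/
def opBNum (z : ℝ → ℂ) : ℝ → ℂ :=
  ∑ i : Fin (m + 2), polyFun ((-1) ^ ((i : ℕ) + (m + 1)) *
    (Matrix.of fun r s : Fin (m + 1) => derivative^[(i.succAbove r : ℕ)] (hTilde lam s)).det) *
      gaussDeriv^[i] z

/-- The denominator of `B`. The sign is its own inverse, so it may be placed here. -/
def opBDen : ℂ[X] := (-1) ^ ((m + 1) / 2) * eta lam ^ (m + 1)

theorem opB_eq_div {z : ℝ → ℂ} (hz : ContDiff ℝ ∞ z) (x : ℝ) :
    opB lam z x = opBNum lam z x / polyFun (opBDen lam) x := by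
  have h : wr deriv (Fin.snoc (α := fun _ => ℝ → ℂ) (fun j => polyFun (hTilde lam j))
      (fun t : ℝ => Complex.exp (-(t : ℂ) ^ 2) * z t)) =
      (fun t : ℝ => Complex.exp (-(t : ℂ) ^ 2)) * opBNum lam z := by
    rw [wr_snoc, opBNum, Finset.mul_sum]
    refine Finset.sum_congr rfl fun i _ => ?_
    simp only [iterate_deriv_polyFun, det_polyFun, iterate_deriv_exp_mul hz]
    simp only [← polyFunHom_apply, map_mul, map_pow, map_neg, map_one]
    have : (fun t : ℝ => Complex.exp (-(t : ℂ) ^ 2) * gaussDeriv^[i] z t) =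
      (fun t : ℝ => Complex.exp (-(t : ℂ) ^ 2)) * gaussDeriv^[i] z := rfl
    rw [this]
    ring
  have e1 : Complex.exp ((x : ℂ) ^ 2) * Complex.exp (-(x : ℂ) ^ 2) = 1 := by
    rw [← Complex.exp_add]; simp
  have e2 : polyFun (opBDen lam) x = (-1) ^ ((m + 1) / 2) * polyFun (eta lam) x ^ (m + 1) := by
    simp [opBDen, polyFun]
  have e3 : (((-1 : ℂ)) ^ ((m + 1) / 2))⁻¹ = (-1) ^ ((m + 1) / 2) := by
    rw [← inv_pow]; norm_num
  rw [opB, h, Pi.mul_apply, e2, div_eq_mul_inv, mul_inv, e3]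
  linear_combination ((-1) ^ ((m + 1) / 2) * (polyFun (eta lam) x ^ (m + 1))⁻¹ *
    opBNum lam z x) * e1

theorem opBNum_polyFun (p : ℂ[X]) :
    opBNum lam (polyFun p) = polyFun (wrGauss (hTilde lam) p) := by
  rw [wrGauss, det_snoc_column, opBNum, ← polyFunHom_apply (∑ _, _), map_sum]
  refine Finset.sum_congr rfl fun i _ => ?_
  rw [iterate_gaussDeriv_polyFun]
  simp only [← polyFunHom_apply, map_mul]
  ring

theorem isPolyDiff_opBNum_mul_opA (f : ℂ[X]) :
    IsPolyDiff fun y => opBNum lam (polyFun f * opA lam y) :=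
  isPolyDiff_sum _ fun _ =>
    (((isPolyDiff_opA lam).polyFun_mul f).iterate_gaussDeriv _).polyFun_mul _

end Operators

/-! ### Existence and uniqueness of `B ∘ f ∘ A` in `ℂ[x, ∂]` -/

section Stabilizer

variable {m : ℕ} {lam : Fin (m + 1) → ℕ} {f : ℂ[X]}

theorem offset_nonneg (hpos : ∀ i, 0 < lam i) : 0 ≤ offset lam := by
  have : m + 1 ≤ partN lam := by
    have := Finset.card_nsmul_le_sum Finset.univ lam 1 fun i _ => hpos i
    simpa [partN] using this
  unfold offset
  omega

/-- `f · A Hₙ` is a combination of the `A Hᵢ` with `i` not among the `kᵢ`, also when `n` is one of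
them: then `A Hₙ = 0`. -/
theorem exists_stabilizer_expansion (hpos : ∀ i, 0 < lam i) (hf : f ∈ stabilizer lam) (n : ℕ) :
    ∃ g : ℕ →₀ ℂ, (∀ i, g (kk lam i) = 0) ∧
      f * opAPoly lam (hermiteH n) = ∑ i ∈ g.support, C (g i) * opAPoly lam (hermiteH i) := by
  by_cases hn : ∃ i, n = kk lam i
  · obtain ⟨i, rfl⟩ := hn
    exact ⟨0, by simp, by simp [opAPoly_hermiteH_kk]⟩
  suffices h : ∀ p ∈ spanU lam, ∃ g : ℕ →₀ ℂ, (∀ i, g (kk lam i) = 0) ∧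
      p = g.sum fun i a => C a * opAPoly lam (hermiteH i) by
    have hmem : (n : ℤ) + offset lam ∈ degSet lam := by
      have := offset_nonneg hpos
      refine ⟨by omega, by omega, fun i hi => hn ⟨i, ?_⟩⟩
      rw [add_sub_cancel_right] at hi
      exact_mod_cast hi
    obtain ⟨g, h1, h2⟩ := h _ (hf _ hmem)
    refine ⟨g, h1, ?_⟩
    rw [hHat, add_sub_cancel_right] at h2
    exact h2
  intro p hp
  induction hp using Submodule.span_induction with
  | mem p hp =>
    obtain ⟨d, ⟨_, h1, h2⟩, rfl⟩ := hp
    obtain ⟨k, hk⟩ := Int.eq_ofNat_of_zero_le (sub_nonneg.2 h1)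
    refine ⟨Finsupp.single k 1, fun i => ?_, ?_⟩
    · refine Finsupp.single_eq_of_ne fun h => h2 i ?_
      rw [hk, h]
    · rw [Finsupp.sum_single_index (by simp), hHat, hk]
      simp [hermiteZ]
  | zero => exact ⟨0, by simp, by simp⟩
  | add p q _ _ hp hq =>
    obtain ⟨g, h1, rfl⟩ := hp
    obtain ⟨g', h1', rfl⟩ := hq
    exact ⟨g + g', fun i => by simp [h1, h1'],
      (Finsupp.sum_add_index' (by simp) (by intros; simp [add_mul])).symm⟩
  | smul c p _ hp =>
    obtain ⟨g, h1, rfl⟩ := hp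
    refine ⟨c • g, fun i => by simp [h1], ?_⟩
    rw [Finsupp.sum_smul_index (by simp), Finsupp.smul_sum]
    simp [smul_eq_C_mul, mul_assoc]

theorem opBNum_opA_hermiteH (hmono : Monotone lam) {n : ℕ} {g : ℕ →₀ ℂ}
    (hg : f * opAPoly lam (hermiteH n) = ∑ i ∈ g.support, C (g i) * opAPoly lam (hermiteH i)) :
    opBNum lam (polyFun f * opA lam (polyFun (hermiteH n))) =
      polyFun (opBDen lam * ∑ i ∈ g.support, C (g i * piVal lam i) * hermiteH i) := by
  rw [opA_polyFun, ← polyFun_mul, hg, opBNum_polyFun, wrGauss_sum, Finset.mul_sum]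
  refine congrArg polyFun (Finset.sum_congr rfl fun i _ => ?_)
  rw [wrGauss_opAPoly_hermiteH hmono, opBDen, C_mul]
  ring

theorem opBDen_ne_zero (hmono : Monotone lam) : opBDen lam ≠ 0 := by
  simp [opBDen, eta_ne_zero hmono]

theorem polyFun_opBDen_ne_zero {x : ℝ} (hx : polyFun (eta lam) x ≠ 0) :
    polyFun (opBDen lam) x ≠ 0 := by
  have : polyFun (opBDen lam) x = (-1) ^ ((m + 1) / 2) * polyFun (eta lam) x ^ (m + 1) := by
    simp [opBDen, polyFun]
  rw [this]
  exact mul_ne_zero (by simp) (pow_ne_zero _ hx)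

theorem opB_mul_opA_eq_div (f : ℂ[X]) {y : ℝ → ℂ} (hy : ContDiff ℝ ∞ y) (x : ℝ) :
    opB lam (polyFun f * opA lam y) x =
      opBNum lam (polyFun f * opA lam y) x / polyFun (opBDen lam) x :=
  opB_eq_div lam (((isPolyDiff_opA lam).polyFun_mul f).contDiff hy) x

/-- The values of `B ∘ f ∘ A` on Hermite polynomials, from `B (A Hᵢ) = π(i) Hᵢ`. -/
theorem IsBfA.applyPoly_hermiteH (hmono : Monotone lam) {Q : PolyDiffOp} (hQ : IsBfA lam f Q)
    {n : ℕ} {g : ℕ →₀ ℂ}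
    (hg : f * opAPoly lam (hermiteH n) = ∑ i ∈ g.support, C (g i) * opAPoly lam (hermiteH i)) :
    Q.applyPoly (hermiteH n) = ∑ i ∈ g.support, C (g i * piVal lam i) * hermiteH i := by
  refine eq_of_polyFun_eq (eta_ne_zero hmono) fun x hx => ?_
  have h := hQ _ (contDiff_polyFun (hermiteH n)) x hx
  rw [opB_mul_opA_eq_div _ (contDiff_polyFun _), opBNum_opA_hermiteH hmono hg,
    PolyDiffOp.apply_polyFun] at h
  rw [h, div_eq_iff (polyFun_opBDen_ne_zero hx), ← polyFunHom_apply, map_mul, mul_comm]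
  rfl

/-- The operator `B ∘ f ∘ A` has rational coefficients with denominators dividing a power of `η`;
as it maps every `Hₙ`, hence every polynomial, to a polynomial, its coefficients are polynomials. -/
theorem exists_isBfA (hpos : ∀ i, 0 < lam i) (hmono : Monotone lam) (hf : f ∈ stabilizer lam) :
    ∃ Q : PolyDiffOp, IsBfA lam f Q := by
  obtain ⟨R, hR⟩ := isPolyDiff_opBNum_mul_opA lam f
  have hH : ∀ n, opBDen lam ∣ R.applyPoly (hermiteH n) := by
    intro n
    obtain ⟨g, _, hg⟩ := exists_stabilizer_expansion hpos hf n
    have h1 := hR _ (contDiff_polyFun (hermiteH n))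
    simp only [opBNum_opA_hermiteH hmono hg, PolyDiffOp.apply_polyFun] at h1
    exact ⟨_, (eq_of_polyFun_eq one_ne_zero fun x _ => congrFun h1 x).symm⟩
  have hall : ∀ p, opBDen lam ∣ R.applyPoly p := by
    intro p
    have hp : p ∈ Submodule.span ℂ (Set.range hermiteH) := span_hermiteH ▸ Submodule.mem_top
    induction hp using Submodule.span_induction with
    | mem p hp =>
      obtain ⟨n, rfl⟩ := hp
      exact hH n
    | zero => rw [PolyDiffOp.applyPoly_zero]; exact dvd_zero _
    | add p q _ _ hp hq => rw [PolyDiffOp.applyPoly_add]; exact dvd_add hp hq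
    | smul c p _ hp => rw [PolyDiffOp.applyPoly_smul, smul_eq_C_mul]; exact hp.mul_left _
  obtain ⟨Q, hQ⟩ := PolyDiffOp.exists_apply_eq_mul_of_dvd (opBDen_ne_zero hmono)
    (PolyDiffOp.dvd_coeff_of_dvd_applyPoly hall)
  refine ⟨Q, fun y hy x hx => ?_⟩
  have h1 : opBNum lam (polyFun f * opA lam y) x = R.apply y x := congrFun (hR y hy) x
  rw [opB_mul_opA_eq_div f hy, h1, hQ, mul_div_cancel_left₀ _ (polyFun_opBDen_ne_zero hx)]

theorem IsBfA.unique (hmono : Monotone lam) {Q Q' : PolyDiffOp} (hQ : IsBfA lam f Q)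
    (hQ' : IsBfA lam f Q') : Q = Q' := by
  have h : ∀ p, Q.applyPoly p = Q'.applyPoly p := fun p =>
    eq_of_polyFun_eq (eta_ne_zero hmono) fun x hx => by
      rw [← PolyDiffOp.apply_polyFun, ← PolyDiffOp.apply_polyFun, hQ _ (contDiff_polyFun p) x hx,
        hQ' _ (contDiff_polyFun p) x hx]
  refine sub_eq_zero.1 (Finsupp.ext fun j => zero_dvd_iff.1 ?_)
  refine PolyDiffOp.dvd_coeff_of_dvd_applyPoly (fun p => ?_) j
  rw [PolyDiffOp.sub_applyPoly, h p, sub_self]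

end Stabilizer

/-! ### Values and poles of rational functions -/

section RationalFunctions

theorem shiftHom_algebraMap (c : ℂ) (p : ℂ[X]) :
    shiftHom c (algebraMap _ _ p) = algebraMap _ _ (taylor c p) := by
  simpa using shiftHom_div c p 1

theorem ofAdd_smul (j : ℤ) (r : RatFunc ℂ) : Multiplicative.ofAdd j • r = shiftHom (j : ℂ) r := rfl

theorem denom_eval_ne_zero_of_eval_ne_zero {a b : ℂ[X]} {t : ℂ} (hb : b.eval t ≠ 0) :
    (algebraMap ℂ[X] (RatFunc ℂ) a / algebraMap _ _ b).denom.eval t ≠ 0 := by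
  intro h
  obtain ⟨c, hc⟩ := RatFunc.denom_div_dvd a b
  exact hb (by rw [hc, eval_mul, h, zero_mul])

theorem eval_div {a b : ℂ[X]} {t : ℂ} (hb : b.eval t ≠ 0) :
    (algebraMap ℂ[X] (RatFunc ℂ) a / algebraMap _ _ b).eval (RingHom.id ℂ) t =
      a.eval t / b.eval t := by
  have hb0 : algebraMap ℂ[X] (RatFunc ℂ) b ≠ 0 := by
    intro h
    rw [(map_eq_zero_iff _ (RatFunc.algebraMap_injective ℂ)).1 h] at hb
    simp at hb
  have h1 := RatFunc.eval_mul (f := RingHom.id ℂ) (a := t)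
    (x := algebraMap ℂ[X] (RatFunc ℂ) a / algebraMap _ _ b) (y := algebraMap _ _ b)
    (by rw [eval₂_id]; exact denom_eval_ne_zero_of_eval_ne_zero hb) (by simp)
  rw [div_mul_cancel₀ _ hb0] at h1
  simp only [RatFunc.eval_algebraMap, Algebra.algebraMap_self, RingHom.id_apply, eval₂_id] at h1
  rw [h1, mul_div_cancel_right₀ _ hb]

theorem denom_eval_ne_zero_of_simple_root {a b : ℂ[X]} {t : ℂ} (ha : a.eval t = 0)
    (hb : b.eval t ≠ 0) :
    (algebraMap ℂ[X] (RatFunc ℂ) a / algebraMap _ _ ((X - C t) * b)).denom.eval t ≠ 0 := by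
  obtain ⟨a', rfl⟩ := dvd_iff_isRoot.2 ha
  have h0 : algebraMap ℂ[X] (RatFunc ℂ) (X - C t) ≠ 0 :=
    (map_ne_zero_iff _ (RatFunc.algebraMap_injective ℂ)).2 (X_sub_C_ne_zero t)
  rw [map_mul, map_mul, mul_div_mul_left _ _ h0]
  exact denom_eval_ne_zero_of_eval_ne_zero hb

end RationalFunctions

/-! ### Difference operators with polynomial coefficients and the map `♭` -/

namespace DiffceOp

theorem mulBy_mul_shift (r : RatFunc ℂ) (j : ℤ) :
    mulBy r * shift j = SkewMonoidAlgebra.single (Multiplicative.ofAdd j) r := by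
  simp [mulBy, shift]

/-- All coefficients of `P` are polynomials in `n`. -/
def IsPoly (P : DiffceOp) : Prop := ∀ j, ∃ p : ℂ[X], P.coeff j = algebraMap _ _ p

/-- The action as a sum over any finite set of shifts that contains the support. -/
theorem act_eq_sum (P : DiffceOp) (u : ℤ → ℂ[X]) (n : ℤ) {s : Finset (Multiplicative ℤ)}
    (hs : P.support ⊆ s) :
    P.act u n = ∑ g ∈ s, C ((P.coeff g).eval (RingHom.id ℂ) (n : ℂ)) * u (n + g.toAdd) :=
  Finset.sum_subset hs fun g _ hg => by
    rw [SkewMonoidAlgebra.notMem_support_iff.1 hg]; simp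

theorem IsPoly.add {P P' : DiffceOp} (h : P.IsPoly) (h' : P'.IsPoly) : (P + P').IsPoly := by
  intro j
  obtain ⟨p, hp⟩ := h j
  obtain ⟨p', hp'⟩ := h' j
  exact ⟨p + p', by rw [SkewMonoidAlgebra.coeff_add, Finsupp.add_apply, hp, hp', map_add]⟩

theorem act_add {P P' : DiffceOp} (h : P.IsPoly) (h' : P'.IsPoly) (u : ℤ → ℂ[X]) (n : ℤ) :
    (P + P').act u n = P.act u n + P'.act u n := by
  classical
  rw [act_eq_sum (P + P') u n SkewMonoidAlgebra.support_add,
    act_eq_sum P u n Finset.subset_union_left, act_eq_sum P' u n Finset.subset_union_right,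
    ← Finset.sum_add_distrib]
  refine Finset.sum_congr rfl fun g _ => ?_
  obtain ⟨p, hp⟩ := h g
  obtain ⟨p', hp'⟩ := h' g
  rw [SkewMonoidAlgebra.coeff_add, Finsupp.add_apply, hp, hp', ← map_add]
  simp only [RatFunc.eval_algebraMap, Algebra.algebraMap_self, RingHom.id_apply, eval₂_id, eval_add,
    C_add, add_mul]

theorem isPoly_zero : IsPoly 0 := fun _ => ⟨0, by simp⟩

theorem isPoly_sum {ι : Type*} (s : Finset ι) {P : ι → DiffceOp} (h : ∀ i, (P i).IsPoly) :
    (∑ i ∈ s, P i).IsPoly := by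
  classical
  induction s using Finset.induction_on with
  | empty => simpa using isPoly_zero
  | insert i s hi ih => rw [Finset.sum_insert hi]; exact (h i).add ih

theorem act_sum {ι : Type*} (s : Finset ι) {P : ι → DiffceOp} (h : ∀ i, (P i).IsPoly)
    (u : ℤ → ℂ[X]) (n : ℤ) : (∑ i ∈ s, P i).act u n = ∑ i ∈ s, (P i).act u n := by
  classical
  induction s using Finset.induction_on with
  | empty => simp [act, SkewMonoidAlgebra.sum]
  | insert i s hi ih =>
    rw [Finset.sum_insert hi, Finset.sum_insert hi, act_add (h i) (isPoly_sum s h), ih]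

theorem coeff_single_mul_of_poly {P : DiffceOp} (j : ℤ) (p : ℂ[X]) {g : Multiplicative ℤ} {q : ℂ[X]}
    (hq : P.coeff ((Multiplicative.ofAdd j)⁻¹ * g) = algebraMap _ _ q) :
    (SkewMonoidAlgebra.single (Multiplicative.ofAdd j) (algebraMap ℂ[X] (RatFunc ℂ) p) *
      P).coeff g =
      algebraMap _ _ (p * taylor (j : ℂ) q) := by
  rw [SkewMonoidAlgebra.coeff_single_mul, hq, ofAdd_smul, shiftHom_algebraMap, map_mul]

theorem IsPoly.single_mul {P : DiffceOp} (h : P.IsPoly) (j : ℤ) (p : ℂ[X]) :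
    IsPoly
      (SkewMonoidAlgebra.single (Multiplicative.ofAdd j) (algebraMap ℂ[X] (RatFunc ℂ) p) * P) := by
  intro g
  obtain ⟨q, hq⟩ := h ((Multiplicative.ofAdd j)⁻¹ * g)
  exact ⟨_, coeff_single_mul_of_poly j p hq⟩

theorem act_single_mul {P : DiffceOp} (h : P.IsPoly) (j : ℤ) (p : ℂ[X]) (u : ℤ → ℂ[X]) (n : ℤ) :
    act (SkewMonoidAlgebra.single (Multiplicative.ofAdd j) (algebraMap ℂ[X] (RatFunc ℂ) p) * P)
      u n =
      C (p.eval (n : ℂ)) * P.act u (n + j) := by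
  classical
  rw [act_eq_sum _ u n (s := P.support.image (Multiplicative.ofAdd j * ·)),
    Finset.sum_image (fun a _ b _ hab => mul_left_cancel hab), act_eq_sum P u _ subset_rfl,
    Finset.mul_sum]
  · refine Finset.sum_congr rfl fun g _ => ?_
    obtain ⟨q, hq⟩ := h g
    rw [coeff_single_mul_of_poly j p (q := q) (by rw [inv_mul_cancel_left, hq]), hq]
    simp only [RatFunc.eval_algebraMap, Algebra.algebraMap_self, RingHom.id_apply, eval₂_id,
      eval_mul, taylor_eval, toAdd_mul, toAdd_ofAdd, Int.cast_add, C_mul, ← add_assoc, mul_assoc]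
  · intro g hg
    rw [SkewMonoidAlgebra.mem_support_iff, SkewMonoidAlgebra.coeff_single_mul] at hg
    refine Finset.mem_image.2 ⟨(Multiplicative.ofAdd j)⁻¹ * g, ?_, mul_inv_cancel_left _ _⟩
    rw [SkewMonoidAlgebra.mem_support_iff]
    intro h0
    rw [h0, smul_zero, mul_zero] at hg
    exact hg rfl

theorem isPoly_one : IsPoly 1 := by
  classical
  intro g
  refine ⟨if 1 = g then 1 else 0, ?_⟩
  rw [SkewMonoidAlgebra.coeff_one, Finsupp.single_apply]
  split_ifs <;> simp

theorem act_one (u : ℤ → ℂ[X]) (n : ℤ) : act 1 u n = u n := by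
  rw [act, SkewMonoidAlgebra.one_def, SkewMonoidAlgebra.sum_single_index] <;> simp

theorem Delta_mul (P : DiffceOp) : Delta * P =
    SkewMonoidAlgebra.single (Multiplicative.ofAdd 1) (algebraMap ℂ[X] (RatFunc ℂ) (C (1 / 2))) *
        P +
      SkewMonoidAlgebra.single (Multiplicative.ofAdd (-1)) (algebraMap ℂ[X] (RatFunc ℂ) X) * P := by
  rw [Delta, mulBy_mul_shift, mulBy_mul_shift, RatFunc.algebraMap_C, RatFunc.algebraMap_X, add_mul]

theorem Gamma_mul (P : DiffceOp) : Gamma * P =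
    SkewMonoidAlgebra.single (Multiplicative.ofAdd (-1)) (algebraMap ℂ[X] (RatFunc ℂ) (2 * X)) *
      P := by
  rw [Gamma, mulBy_mul_shift, map_mul, RatFunc.algebraMap_X, map_ofNat]

theorem mulBy_C_mul (c : ℂ) (P : DiffceOp) : mulBy (RatFunc.C c) * P =
    SkewMonoidAlgebra.single (Multiplicative.ofAdd 0) (algebraMap ℂ[X] (RatFunc ℂ) (C c)) * P := by
  rw [RatFunc.algebraMap_C]; rfl

theorem isPoly_Delta_pow (i : ℕ) : IsPoly (Delta ^ i) := by
  induction i with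
  | zero => rw [pow_zero]; exact isPoly_one
  | succ i ih => rw [pow_succ', Delta_mul]; exact (ih.single_mul _ _).add (ih.single_mul _ _)

theorem isPoly_Gamma_pow_mul {P : DiffceOp} (h : P.IsPoly) (j : ℕ) : IsPoly (Gamma ^ j * P) := by
  induction j with
  | zero => simpa using h
  | succ j ih => rw [pow_succ', mul_assoc, Gamma_mul]; exact ih.single_mul _ _

/-- `Δ` acts on the Hermite polynomials as multiplication by `x`. For `n = 0` the recurrence would
involve `h(-1, x)`, but the coefficient `n` of `Θ⁻¹` vanishes there. -/
theorem act_Delta_pow (i : ℕ) : ∀ n : ℕ, (Delta ^ i).act hermiteZ n = X ^ i * hermiteH n := by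
  induction i with
  | zero => intro n; simp [act_one, hermiteZ]
  | succ i ih =>
    intro n
    have hP := isPoly_Delta_pow i
    rw [pow_succ', Delta_mul, act_add (hP.single_mul _ _) (hP.single_mul _ _),
      act_single_mul hP, act_single_mul hP]
    have h1 := ih (n + 1)
    push_cast at h1
    rw [h1]
    have h2 : (2 : ℂ[X]) * C (1 / 2) = 1 := by rw [← C_ofNat, ← C_mul]; norm_num
    cases n with
    | zero =>
      simp only [hermiteH, Nat.cast_zero, Int.cast_zero, eval_C, eval_X, C_0, zero_mul, add_zero,
        derivative_one]
      linear_combination X ^ (i + 1) * h2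
    | succ n =>
      have h3 := ih n
      have h4 : ((n + 1 : ℕ) : ℤ) + -1 = n := by push_cast; ring
      rw [h4, h3, hermiteH, derivative_hermiteH_succ, eval_C, eval_X]
      push_cast
      simp only [C_mul, C_ofNat]
      linear_combination
        (X ^ (i + 1) * hermiteH (n + 1) - X ^ i * C ((n : ℂ) + 1) * hermiteH n) * h2

/-- `Γ` acts on the Hermite polynomials as the derivative; the order of the factors is reversed
because operators in `n` commute with operators in `x`. -/
theorem act_Gamma_pow_mul (i j : ℕ) : ∀ n : ℕ,
    (Gamma ^ j * Delta ^ i).act hermiteZ n = X ^ i * derivative^[j] (hermiteH n) := by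
  induction j with
  | zero => intro n; rw [pow_zero, one_mul, act_Delta_pow]; rfl
  | succ j ih =>
    intro n
    rw [pow_succ', mul_assoc, Gamma_mul,
      act_single_mul (isPoly_Gamma_pow_mul (isPoly_Delta_pow i) j)]
    cases n with
    | zero => simp [hermiteH]
    | succ n =>
      have h4 : ((n + 1 : ℕ) : ℤ) + -1 = n := by push_cast; ring
      rw [h4, ih, Function.iterate_succ_apply, derivative_hermiteH_succ, iterate_derivative_C_mul]
      simp
      ring

theorem isPoly_mulBy_C_mul {P : DiffceOp} (h : P.IsPoly) (c : ℂ) :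
    IsPoly (mulBy (RatFunc.C c) * P) := by
  rw [mulBy_C_mul]; exact h.single_mul _ _

end DiffceOp

open DiffceOp

theorem isPoly_flat (Q : PolyDiffOp) : (flat Q).IsPoly :=
  isPoly_sum _ fun j => isPoly_sum _ fun _ =>
    isPoly_mulBy_C_mul (isPoly_Gamma_pow_mul (isPoly_Delta_pow _) j) _

theorem act_flat_hermiteZ (Q : PolyDiffOp) (n : ℕ) :
    (flat Q).act hermiteZ n = Q.applyPoly (hermiteH n) := by
  have hP := fun i j => isPoly_Gamma_pow_mul (isPoly_Delta_pow i) j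
  rw [flat, Finsupp.sum]
  simp only [Polynomial.sum]
  rw [act_sum _ fun j => isPoly_sum _ fun i => isPoly_mulBy_C_mul (hP i j) _]
  refine Finset.sum_congr rfl fun j _ => ?_
  rw [act_sum _ fun i => isPoly_mulBy_C_mul (hP i j) _]
  have e : Q j * derivative^[j] (hermiteH n) =
      ∑ i ∈ (Q j).support, C ((Q j).coeff i) * X ^ i * derivative^[j] (hermiteH n) := by
    rw [← Finset.sum_mul]
    exact congrArg (· * derivative^[j] (hermiteH n)) (Q j).sum_C_mul_X_pow_eq.symm
  refine Eq.trans ?_ e.symm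
  refine Finset.sum_congr rfl fun i _ => ?_
  rw [mulBy_C_mul, act_single_mul (hP i j), add_zero, act_Gamma_pow_mul, eval_C, mul_assoc]

/-! ### Coordinates with respect to the Hermite polynomials -/

section Coordinates

/-- The basis of `ℂ[X]` formed by the Hermite polynomials. -/
def hermiteBasis : Module.Basis ℕ ℂ ℂ[X] :=
  hermiteSequence.basis fun i => (leadingCoeff_ne_zero.2 (hermiteSequence.ne_zero i)).isUnit

/-- The coefficient of `H_k` in the expansion of a polynomial in Hermite polynomials. -/
def hermiteCoord (k : ℕ) : ℂ[X] →ₗ[ℂ] ℂ := hermiteBasis.coord k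

theorem hermiteCoord_hermiteZ (k : ℕ) (z : ℤ) :
    hermiteCoord k (hermiteZ z) = if z = k then 1 else 0 := by
  cases z with
  | ofNat n =>
    have h : hermiteZ (Int.ofNat n) = hermiteBasis n := (hermiteSequence.basis_eq_self _ n).symm
    rw [h, hermiteCoord, Module.Basis.coord_apply, Module.Basis.repr_self, Finsupp.single_apply]
    simp
  | negSucc n =>
    rw [if_neg (by omega)]
    exact map_zero _

theorem hermiteCoord_C_mul (k : ℕ) (a : ℂ) (z : ℤ) :
    hermiteCoord k (C a * hermiteZ z) = if z = k then a else 0 := by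
  rw [← smul_eq_C_mul, map_smul, hermiteCoord_hermiteZ]
  simp

end Coordinates

/-! ### The difference operator `Δ̂_f` -/

section Eigenvalue

variable {m : ℕ} {lam : Fin (m + 1) → ℕ} {f : ℂ[X]}

/-- The values of the coefficients of `♭(Q)` at `n ≥ 0` are read off from the Hermite expansion of
`Q Hₙ`. The shifts to negative indices remain undetermined, since `h(k, x) = 0` for `k < 0`. -/
theorem coeff_flat_eval_of_expansion {Q : PolyDiffOp} {n : ℕ} {γ : ℕ →₀ ℂ}
    (h : Q.applyPoly (hermiteH n) = ∑ i ∈ γ.support, C (γ i * piVal lam i) * hermiteH i)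
    {j : ℤ} {k : ℕ} (hk : (n : ℤ) + j = k) :
    ((flat Q).coeff (Multiplicative.ofAdd j)).eval (RingHom.id ℂ) (n : ℂ) =
      γ k * piVal lam k := by
  have h1 := congrArg (hermiteCoord k) ((act_flat_hermiteZ Q n).trans h)
  rw [act_eq_sum _ _ _ subset_rfl, map_sum, map_sum] at h1
  have hH : ∀ i : ℕ, hermiteH i = hermiteZ i := fun _ => rfl
  simp only [hermiteCoord_C_mul, hH, Int.cast_natCast, Nat.cast_inj, Finset.sum_ite_eq'] at h1
  rw [Finset.sum_eq_single (Multiplicative.ofAdd j), toAdd_ofAdd, if_pos hk] at h1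
  · rw [h1]
    split_ifs with hs
    · rfl
    · rw [Finsupp.notMem_support_iff.1 hs, zero_mul]
  · intro g _ hg
    rw [if_neg]
    intro h2
    apply hg
    rw [← ofAdd_toAdd g]
    congr 1
    omega
  · intro hj
    rw [SkewMonoidAlgebra.notMem_support_iff.1 hj]
    simp

/-- `π` as a polynomial. -/
def piPolynomial (lam : Fin (m + 1) → ℕ) : ℂ[X] := ∏ i, (-2 * X + 2 * C (kk lam i : ℂ))

theorem algebraMap_piPolynomial :
    algebraMap ℂ[X] (RatFunc ℂ) (piPolynomial lam) = piPoly lam := by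
  simp only [piPolynomial, piPoly, map_prod, map_add, map_mul, map_neg, map_ofNat,
    RatFunc.algebraMap_X, RatFunc.algebraMap_C]

theorem piPolynomial_eval (z : ℂ) : (piPolynomial lam).eval z = piVal lam z := by
  simp [piPolynomial, piVal, eval_prod]

theorem piVal_intCast_ne_zero {z : ℤ} (hz : ∀ i, z ≠ kk lam i) : piVal lam z ≠ 0 := by
  refine Finset.prod_ne_zero_iff.2 fun i _ h => hz i ?_
  have : (z : ℂ) = (kk lam i : ℂ) := by linear_combination (-1 / 2) * h
  exact_mod_cast this

/-- The zeros of `π(n)` are simple, because the `kᵢ` are distinct. -/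
theorem exists_taylor_piPolynomial_eq (hmono : Monotone lam) (s t : ℤ) {i : Fin (m + 1)}
    (h : t + s = kk lam i) : ∃ b : ℂ[X], b.eval (t : ℂ) ≠ 0 ∧
      taylor (s : ℂ) (piPolynomial lam) = (X - C (t : ℂ)) * b := by
  refine ⟨-2 * ∏ k ∈ Finset.univ.erase i, (-2 * (X + C (s : ℂ)) + 2 * C (kk lam k : ℂ)), ?_, ?_⟩
  · rw [eval_mul, eval_prod]
    refine mul_ne_zero (by simp) (Finset.prod_ne_zero_iff.2 fun k hk h0 => ?_)
    refine Finset.ne_of_mem_erase hk (kk_injective hmono ?_)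
    have h1 : ((t + s : ℤ) : ℂ) = (kk lam i : ℂ) := by rw [h]; simp
    push_cast at h1
    simp only [eval_add, eval_mul, eval_neg, eval_X, eval_C, eval_ofNat] at h0
    have : (kk lam k : ℂ) = kk lam i := by linear_combination h0 / 2 + h1
    exact_mod_cast this
  · have h1 : (C (t : ℂ) : ℂ[X]) + C (s : ℂ) = C (kk lam i : ℂ) := by
      rw [← C_add, ← Int.cast_add, h]; simp
    rw [taylor_apply, piPolynomial, prod_comp, ← Finset.mul_prod_erase _ _ (Finset.mem_univ i)]
    simp only [add_comp, mul_comp, neg_comp, X_comp, C_comp, ofNat_comp]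
    linear_combination (-2 * ∏ k ∈ Finset.univ.erase i,
      (-2 * (X + C (s : ℂ)) + 2 * C (kk lam k : ℂ))) * h1

/-- The coefficient of `Θʲ` in `Δ̂_f` is that in `♭(Q)` divided by `π(n + j)`, translated by
`N - ℓ`. -/
theorem coeff_hatDelta (Q : PolyDiffOp) {j : ℤ} {q : ℂ[X]}
    (hq : (flat Q).coeff (Multiplicative.ofAdd j) = algebraMap _ _ q) :
    (hatDelta lam Q).coeff (Multiplicative.ofAdd j) =
      algebraMap ℂ[X] (RatFunc ℂ) (taylor ((-offset lam : ℤ) : ℂ) q) /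
        algebraMap _ _ (taylor ((j - offset lam : ℤ) : ℂ) (piPolynomial lam)) := by
  have e : (Multiplicative.ofAdd (-offset lam))⁻¹ *
      (Multiplicative.ofAdd j * (Multiplicative.ofAdd (offset lam))⁻¹) =
        Multiplicative.ofAdd j := by
    rw [ofAdd_neg, inv_inv, mul_comm, inv_mul_cancel_right]
  rw [hatDelta, mul_assoc (shift _), shift, mulBy, shift, SkewMonoidAlgebra.coeff_mul_single,
    SkewMonoidAlgebra.coeff_single_mul, smul_one, mul_one, one_mul, e,
    SkewMonoidAlgebra.coeff_mul_single_one, hq, ofAdd_smul, ofAdd_smul, map_inv₀,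
    ← algebraMap_piPolynomial, shiftHom_algebraMap, ← div_eq_mul_inv, shiftHom_div, taylor_taylor]
  congr 4
  push_cast
  ring

/-- Regularity and the eigenvalue equation, given the expansions of `f · A Hₙ` and of `Q Hₙ`. The
coefficient of `Θʲ` in `♭(Q)` takes at `n` the value `γ(n + j) π(n + j)`, so division by `π(n + j)`
leaves the coefficients of the first expansion. -/
theorem hatDelta_regularAt_and_act (hmono : Monotone lam) {Q : PolyDiffOp} {n : ℕ} {γ : ℕ →₀ ℂ}
    (hγ : ∀ i, γ (kk lam i) = 0)
    (hf : f * opAPoly lam (hermiteH n) = ∑ i ∈ γ.support, C (γ i) * opAPoly lam (hermiteH i))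
    (hQ : Q.applyPoly (hermiteH n) = ∑ i ∈ γ.support, C (γ i * piVal lam i) * hermiteH i) :
    (hatDelta lam Q).RegularAt (n + offset lam) ∧
      (hatDelta lam Q).act (hHat lam) (n + offset lam) = f * hHat lam (n + offset lam) := by
  classical
  set P := hatDelta lam Q with hP
  have den : ∀ j : ℤ, (taylor ((j - offset lam : ℤ) : ℂ) (piPolynomial lam)).eval
      ((n + offset lam : ℤ) : ℂ) = piVal lam ((n + j : ℤ) : ℂ) := by
    intro j
    rw [taylor_eval, piPolynomial_eval]
    congr 1
    push_cast
    ring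
  have num : ∀ q : ℂ[X], (taylor ((-offset lam : ℤ) : ℂ) q).eval
      ((n + offset lam : ℤ) : ℂ) = q.eval (n : ℂ) := by
    intro q
    rw [taylor_eval]
    congr 1
    push_cast
    ring
  constructor
  · intro j
    obtain ⟨q, hq⟩ := isPoly_flat Q (Multiplicative.ofAdd j)
    rw [coef, hP, coeff_hatDelta Q hq]
    by_cases hj : ∃ i, (n : ℤ) + j = kk lam i
    -- A zero of `π(n + j)` is simple and cancels against a zero of the numerator.
    · obtain ⟨i, hi⟩ := hj
      obtain ⟨b, hb, hb'⟩ := exists_taylor_piPolynomial_eq hmono (j - offset lam)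
        (n + offset lam) (i := i) (by rw [← hi]; ring)
      rw [hb']
      refine denom_eval_ne_zero_of_simple_root ?_ hb
      have h0 := coeff_flat_eval_of_expansion hQ hi
      rw [hq, hγ, zero_mul] at h0
      rw [num]
      simpa using h0
    · refine denom_eval_ne_zero_of_eval_ne_zero ?_
      rw [den]
      exact piVal_intCast_ne_zero fun i hi => hj ⟨i, hi⟩
  · have hA : ∀ z : ℤ, hHat lam (n + offset lam + z) = opAPoly lam (hermiteZ (n + z)) := by
      intro z
      rw [hHat]
      congr 2
      ring
    have hneg : ∀ z : ℤ, z < 0 → opAPoly lam (hermiteZ z) = 0 := by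
      intro z hz
      obtain ⟨k, rfl⟩ := Int.eq_negSucc_of_lt_zero hz
      exact opAPoly_zero
    -- Where `n + j` is negative or one of the `kᵢ`, the polynomial `A (h(n + j, x))` vanishes, so
    -- the coefficient, which is not known or not `γ(n + j)` there, does not matter.
    have term : ∀ g : Multiplicative ℤ,
        C ((P.coeff g).eval (RingHom.id ℂ) ((n + offset lam : ℤ) : ℂ)) *
          hHat lam (n + offset lam + g.toAdd) =
        C (γ ((n : ℤ) + g.toAdd).toNat) * opAPoly lam (hermiteZ (n + g.toAdd)) := by
      intro g
      rw [hA]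
      rcases lt_or_ge ((n : ℤ) + g.toAdd) 0 with hlt | hge
      · rw [hneg _ hlt, mul_zero, mul_zero]
      obtain ⟨k, hk⟩ := Int.eq_ofNat_of_zero_le hge
      by_cases hj : ∃ i, k = kk lam i
      · obtain ⟨i, rfl⟩ := hj
        have : opAPoly lam (hermiteZ (kk lam i : ℤ)) = 0 := opAPoly_hermiteH_kk i
        rw [hk, this, mul_zero, mul_zero]
      · congr 2
        obtain ⟨q, hq⟩ := isPoly_flat Q (Multiplicative.ofAdd g.toAdd)
        have hπ : piVal lam ((n + g.toAdd : ℤ) : ℂ) ≠ 0 :=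
          piVal_intCast_ne_zero fun i hi => hj ⟨i, by rw [hk] at hi; exact_mod_cast hi⟩
        have h0 := coeff_flat_eval_of_expansion hQ hk
        rw [hq] at h0
        simp only [RatFunc.eval_algebraMap, Algebra.algebraMap_self, RingHom.id_apply,
          eval₂_id] at h0
        have h1 := coeff_hatDelta (lam := lam) Q hq
        rw [ofAdd_toAdd] at h1
        rw [hP, h1, eval_div (by rw [den]; exact hπ), num, den, h0, div_eq_iff hπ, hk]
        simp
    set s : Finset (Multiplicative ℤ) :=
      γ.support.image fun i : ℕ => Multiplicative.ofAdd ((i : ℤ) - n) with hs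
    rw [act_eq_sum P _ _ (s := P.support ∪ s) Finset.subset_union_left]
    simp only [term]
    rw [← Finset.sum_subset (s₁ := s) Finset.subset_union_right, hs, Finset.sum_image]
    · have h2 := hA 0
      rw [add_zero, add_zero] at h2
      rw [h2]
      refine Eq.trans (Finset.sum_congr rfl fun i _ => ?_) hf.symm
      rw [toAdd_ofAdd, add_sub_cancel, Int.toNat_natCast]
      rfl
    · intro a _ b _ hab
      have := Multiplicative.ofAdd.injective hab
      omega
    · intro g _ hg
      rcases lt_or_ge ((n : ℤ) + g.toAdd) 0 with hlt | hge
      · rw [hneg _ hlt, mul_zero]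
      obtain ⟨k, hk⟩ := Int.eq_ofNat_of_zero_le hge
      have : γ k = 0 := by
        by_contra h0
        refine hg (Finset.mem_image.2 ⟨k, Finsupp.mem_support_iff.2 h0, ?_⟩)
        rw [← ofAdd_toAdd g]
        congr 1
        omega
      rw [hk, Int.toNat_natCast, this, C_0, zero_mul]

end Eigenvalue

end XHermite

end

theorem theorem5 {m : ℕ} (lam : Fin (m + 1) → ℕ) (hpos : ∀ i, 0 < lam i) (hmono : Monotone lam)
    (f : ℂ[X]) (hf : f ∈ stabilizer lam) :
    (∃! Q : PolyDiffOp, IsBfA lam f Q) ∧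
      ∀ Q : PolyDiffOp, IsBfA lam f Q → ∀ n : ℤ, offset lam ≤ n →
        (hatDelta lam Q).RegularAt n ∧
          (hatDelta lam Q).act (hHat lam) n = f * hHat lam n := by
  obtain ⟨Q₀, hQ₀⟩ := exists_isBfA hpos hmono hf
  refine ⟨⟨Q₀, hQ₀, fun Q hQ => hQ.unique hmono hQ₀⟩, fun Q hQ n hn => ?_⟩
  obtain ⟨k, hk⟩ := Int.eq_ofNat_of_zero_le (sub_nonneg.2 hn)
  obtain rfl : n = k + offset lam := by rw [← hk]; ring
  obtain ⟨γ, hγ, hf'⟩ := exists_stabilizer_expansion hpos hf k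
  exact hatDelta_regularAt_and_act hmono hγ hf' (hQ.applyPoly_hermiteH hmono hf')
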